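/- Let $X$ and $Y$ be compact metrizable spaces, $X\neq\emptyset$, with their Borel $\sigma$-algebras; let $\mathcal P(X)$, $\mathcal P(Y)$ be the sets of Borel probability measures with the weak$^*$ topology (duality with continuous functions). Let $\mathcal T:\mathcal P(X)\times\mathcal P(Y)\to\mathbb R\cup\{+\infty\}$ be any functional, put $D_1(\mathcal T)=\{\mu\in\mathcal P(X):\ \mathcal T(\mu,\nu)<+\infty\text{ for some }\nu\in\mathcal P(Y)\}$, and for $\mu\in\mathcal P(X)$, $g\in C(Y)$ let $$\mathcal T_\mu^*(g)=\sup\Big\{\int_Y g\,d\nu-\mathcal T(\mu,\nu):\ \nu\in\mathcal P(Y)\Big\}.$$ Call $\mathcal T$ a backward linear transfer if it is proper, jointly convex and weak$^*$ lower semicontinuous on $\mathcal P(X)\times\mathcal P(Y)$ and there is a map $T^-:C(Y)\to USC(X)$ into the real-valued upper semicontinuous functions on $X$ (a backward Kantorovich operator of $\mathcal T$) such that for every $\mu\in D_1(\mathcal T)$ and $g\in C(Y)$ the function $T^-g$ is $\mu$-integrable and $\mathcal T_\mu^*(g)=\int_X T^-g\,d\mu$. Assume that $\delta_x\in D_1(\mathcal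 T)$ for every $x\in X$. Then $\mathcal T$ is a backward linear transfer if and only if there is a (jointly) lower semicontinuous function $c:X\times\mathcal P(Y)\to\mathbb R\cup\{+\infty\}$, with $\sigma\mapsto c(x,\sigma)$ convex on $\mathcal P(Y)$ for each $x\in X$, such that for all $\mu\in\mathcal P(X)$ and $\nu\in\mathcal P(Y)$ $$\mathcal T(\mu,\nu)=\inf\Big\{\int_X c(x,\pi_x)\,d\mu(x):\ \pi\in\mathcal K(\mu,\nu)\Big\},$$ where $\mathcal K(\mu,\nu)$ is the set of Borel probability measures on $X\times Y$ with marginals $\mu$ and $\nu$, and $x\mapsto\pi_x$ is the disintegration of $\pi$ along $\mu$, i.e. $\pi(dx,dy)=\mu(dx)\,\pi_x(dy)$. Moreover, if $\mathcal T$ is a backward linear transfer, then every backward Kantorovich operator $T^-$ of $\mathcal T$ is given, for all $g\in C(Y)$ and $x\in X$, by $$T^-g(x)=\sup\Big\{\int_Y g\,d\sigma-\mathcal T(\delta_x,\sigma):\ \sigma\in\mathcal P(Y)\Big\}.$$ -/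

import Mathlib

open MeasureTheory ProbabilityTheory

noncomputable section

namespace Transfer

/-- The convex combination `(1 - t) μ₀ + t μ₁` of two probability measures. -/
def mix {Ω : Type*} [MeasurableSpace Ω] (t : unitInterval) (μ₀ μ₁ : ProbabilityMeasure Ω) :
    ProbabilityMeasure Ω :=
  ⟨ENNReal.ofReal (1 - (t : ℝ)) • (μ₀ : Measure Ω) + ENNReal.ofReal (t : ℝ) • (μ₁ : Measure Ω), by
    constructor
    have h0 : 0 ≤ 1 - (t : ℝ) := sub_nonneg.2 t.2.2
    have h1 : 0 ≤ (t : ℝ) := t.2.1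
    simp only [Measure.coe_add, Measure.coe_smul, Pi.add_apply, Pi.smul_apply, measure_univ,
      smul_eq_mul, mul_one]
    rw [← ENNReal.ofReal_add h0 h1]
    simp⟩

/-- Convexity of an extended-real-valued function on `P(Ω)`. -/
def ConvexOnProb {Ω : Type*} [MeasurableSpace Ω] (F : ProbabilityMeasure Ω → EReal) : Prop :=
  ∀ (t : unitInterval) (σ₀ σ₁ : ProbabilityMeasure Ω),
    F (mix t σ₀ σ₁) ≤ ((1 - (t : ℝ) : ℝ) : EReal) * F σ₀ + ((t : ℝ) : EReal) * F σ₁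

/-- The integral `∫ f dμ = ∫ f⁺ dμ - ∫ f⁻ dμ` of an extended-real-valued function; it is used
only for measurable functions that are bounded below. -/
def erealIntegral {Ω : Type*} [MeasurableSpace Ω] (μ : Measure Ω) (f : Ω → EReal) : EReal :=
  ((∫⁻ x, (f x).toENNReal ∂μ : ENNReal) : EReal) - ((∫⁻ x, (-f x).toENNReal ∂μ : ENNReal) : EReal)

section Definitions

variable {X Y : Type*} [MeasurableSpace X] [MeasurableSpace Y]

/-- Joint convexity of a functional on `P(X) × P(Y)`. -/
def JointlyConvex (T : ProbabilityMeasure X → ProbabilityMeasure Y → EReal) : Prop :=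
  ∀ (t : unitInterval) (μ₀ μ₁ : ProbabilityMeasure X) (ν₀ ν₁ : ProbabilityMeasure Y),
    T (mix t μ₀ μ₁) (mix t ν₀ ν₁) ≤
      ((1 - (t : ℝ) : ℝ) : EReal) * T μ₀ ν₀ + ((t : ℝ) : EReal) * T μ₁ ν₁

/-- The effective domain `D(T)`: the pairs at which `T` is finite. -/
def effectiveDomain (T : ProbabilityMeasure X → ProbabilityMeasure Y → EReal) :
    Set (ProbabilityMeasure X × ProbabilityMeasure Y) :=
  {p | T p.1 p.2 ≠ ⊥ ∧ T p.1 p.2 ≠ ⊤}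

/-- The first partial domain `D₁(T)`. -/
def firstDomain (T : ProbabilityMeasure X → ProbabilityMeasure Y → EReal) :
    Set (ProbabilityMeasure X) :=
  {μ | ∃ ν, (μ, ν) ∈ effectiveDomain T}

/-- The set `K(μ, ν)` of transport plans. -/
def couplings (μ : ProbabilityMeasure X) (ν : ProbabilityMeasure Y) :
    Set (ProbabilityMeasure (X × Y)) :=
  {π | (π : Measure (X × Y)).fst = μ ∧ (π : Measure (X × Y)).snd = ν}

/-- The Markov kernel `κ` is a disintegration `x ↦ π_x` of the plan `π` along its first
marginal `μ`, i.e. `π(dx, dy) = μ(dx) π_x(dy)`. -/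
def IsDisintegration (κ : Kernel X Y) (μ : ProbabilityMeasure X)
    (π : ProbabilityMeasure (X × Y)) : Prop :=
  (π : Measure (X × Y)) = (μ : Measure X) ⊗ₘ κ

/-- The values `∫ c(x, π_x) dμ(x)` obtained as `π` runs through `K(μ, ν)`. -/
def weakTransportValues (c : X → ProbabilityMeasure Y → EReal)
    (μ : ProbabilityMeasure X) (ν : ProbabilityMeasure Y) : Set EReal :=
  {r | ∃ π ∈ couplings μ ν, ∃ (κ : Kernel X Y) (_ : IsMarkovKernel κ), IsDisintegration κ μ π ∧
    r = erealIntegral (μ : Measure X) fun x => c x ⟨κ x, inferInstance⟩}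

/-- The generalized optimal transport cost `inf_π ∫ c(x, π_x) dμ(x)` over `π ∈ K(μ, ν)`. -/
def weakTransport (c : X → ProbabilityMeasure Y → EReal)
    (μ : ProbabilityMeasure X) (ν : ProbabilityMeasure Y) : EReal :=
  sInf (weakTransportValues c μ ν)

end Definitions

section Topological

variable {X Y : Type*} [TopologicalSpace X] [MeasurableSpace X]
  [TopologicalSpace Y] [MeasurableSpace Y]

/-- The Legendre transform `g ↦ sup_σ (∫ g dσ - F σ)` of a functional on `P(Y)`. -/
def legendre (F : ProbabilityMeasure Y → EReal) (g : C(Y, ℝ)) : EReal :=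
  ⨆ σ : ProbabilityMeasure Y, ((∫ y, g y ∂(σ : Measure Y) : ℝ) : EReal) - F σ

/-- `S : C(Y) → USC(X)` is a backward Kantorovich operator for `T`:
`T_μ^*(g) = ∫ S g dμ` for all `μ ∈ D₁(T)` and `g ∈ C(Y)`, the integral being finite. -/
def IsBackwardKantorovichOperator (T : ProbabilityMeasure X → ProbabilityMeasure Y → EReal)
    (S : C(Y, ℝ) → X → ℝ) : Prop :=
  (∀ g, UpperSemicontinuous (S g)) ∧
  ∀ μ ∈ firstDomain T, ∀ g : C(Y, ℝ),
    Integrable (S g) (μ : Measure X) ∧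
    legendre (T μ) g = ((∫ x, S g x ∂(μ : Measure X) : ℝ) : EReal)

/-- Backward linear transfers: proper, convex, weak* lower semicontinuous functionals with values
in `(-∞, +∞]` that have a backward Kantorovich operator. -/
def IsBackwardLinearTransfer [OpensMeasurableSpace X] [OpensMeasurableSpace Y]
    (T : ProbabilityMeasure X → ProbabilityMeasure Y → EReal) : Prop :=
  (∀ μ ν, T μ ν ≠ ⊥) ∧ (∃ μ ν, T μ ν ≠ ⊤) ∧ JointlyConvex T ∧
  LowerSemicontinuous (Function.uncurry T) ∧
  ∃ S : C(Y, ℝ) → X → ℝ, IsBackwardKantorovichOperator T S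

end Topological

end Transfer

end

/-!
Write `Φ(c)` for the set of pairs `(f, g)` of continuous functions with
`f x + ∫ g dσ ≤ c x σ` for all `x` and `σ` (`dualPairs`). Everything follows from the duality
formula `weakTransport c μ ν = sup {∫ f dμ + ∫ g dν : (f, g) ∈ Φ(c)}` (`weakTransport_eq_iSup`),
valid for every lower semicontinuous `c > -∞` that is convex in the second variable.

*Duality.* The inequality `≥` is integration along a disintegration. For `≤`, let `r` be the
supremum. The class of continuous `Ψ` on `X × Y` with `∫ Ψ(x, ·) dσ ≤ c x σ` (`subcosts`) is convex,
so a Hahn–Banach separation in `C(X × Y)` followed by the Riesz representation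
(`exists_prob_integral_nonpos`) gives one plan `π ∈ K(μ, ν)` with `∫ Ψ dπ ≤ r` for all these `Ψ`
(`exists_plan_integral_le`). It remains to see `∫ c(x, π_x) dμ ≤ r`. By the Fenchel–Moreau theorem
on the compact convex set `P(Y)` and a bump function in `x`, `c` is the supremum of countably many
pairs `(f_n, g_n) ∈ Φ(c)` (`exists_seq_dualPairs`). The partial maxima of
`f_n(x) + ∫ g_n dπ_x` are the integrals over `y` of functions that switch between the `f_n + g_n` on
measurable subsets of `X`; replacing the indicators by continuous weights makes these
functions `L¹(π)`-limits of subcosts (`IsSubcostLimit.ite`), and monotone convergence concludes.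

*From a cost to a transfer.* By duality `weakTransport c` is a supremum of continuous affine
functionals, hence jointly convex and lower semicontinuous. Its operator is
`S g x = sup_σ (∫ g dσ - c x σ)`, and `(f, g) ∈ Φ(c)` if and only if `f ≤ -S g`. That the Legendre
transform at `μ` equals `∫ S g dμ` needs one measure `ν` almost optimal for `μ`; instead of a
measurable selection it is found by `exists_prob_integral_nonpos` on `Y` (`legendre_weakTransport`).

*From a transfer to a cost.* Take `c x σ = T δ_x σ`. Continuous affine minorants of `T`, of which
`T` is the supremum by Fenchel–Moreau, restrict to elements of `Φ(c)`. Conversely `(f, g) ∈ Φ(c)`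
means `f ≤ -S g`, and `T_μ^* g = ∫ S g dμ` turns this into `∫ f dμ + ∫ g dν ≤ T μ ν`. Hence `T` and
`weakTransport c` are the same supremum.
-/

set_option linter.unusedSectionVars false

namespace Transfer

open Topology Filter

/-! ### Convex duality on spaces of probability measures -/

section FenchelMoreau

/-- A continuous linear functional on a power of `ℝ` depends on finitely many coordinates. -/
lemma exists_finset_forall_eq_sum {ι : Type*} [DecidableEq ι] (φ : (ι → ℝ) →L[ℝ] ℝ) :
    ∃ s : Finset ι, ∀ v, φ v = ∑ i ∈ s, φ (Pi.single i 1) * v i := by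
  have h0 : φ ⁻¹' Metric.ball 0 1 ∈ 𝓝 (0 : ι → ℝ) :=
    φ.continuous.continuousAt.preimage_mem_nhds
      (by simpa using Metric.ball_mem_nhds (0 : ℝ) one_pos)
  rw [nhds_pi, Filter.mem_pi] at h0
  obtain ⟨I, hI, t, ht, hsub⟩ := h0
  have hker : ∀ w : ι → ℝ, (∀ i ∈ I, w i = 0) → φ w = 0 := by
    intro w hw
    by_contra hne
    have hmem : (φ w)⁻¹ • w ∈ I.pi t := fun i hi => by
      simpa [hw i hi] using mem_of_mem_nhds (ht i)
    have := hsub hmem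
    simp [hne] at this
  refine ⟨hI.toFinset, fun v => ?_⟩
  have h := hker (v - ∑ i ∈ hI.toFinset, v i • Pi.single i (1 : ℝ)) fun i hi => by
    rw [Pi.sub_apply, Finset.sum_apply, Finset.sum_eq_single i]
    · simp
    · intro j _ hj
      simp [hj.symm]
    · simp [hi]
  rw [map_sub, map_sum, sub_eq_zero] at h
  rw [h]
  exact Finset.sum_congr rfl fun i _ => by rw [map_smul, smul_eq_mul, mul_comm]

lemma exists_real_le {Z : Type*} [TopologicalSpace Z] [CompactSpace Z] {F : Z → EReal}
    (hF : LowerSemicontinuous F) (hbot : ∀ z, F z ≠ ⊥) : ∃ m : ℝ, ∀ z, (m : EReal) ≤ F z := by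
  rcases isEmpty_or_nonempty Z with _ | _
  · exact ⟨0, fun z => isEmptyElim z⟩
  obtain ⟨z, -, hz⟩ := (hF.lowerSemicontinuousOn Set.univ).exists_isMinOn Set.univ_nonempty
    isCompact_univ
  obtain ⟨m, -, hm⟩ := EReal.lt_iff_exists_real_btwn.1 (bot_lt_iff_ne_bot.2 (hbot z))
  exact ⟨m, fun w => hm.le.trans (hz (Set.mem_univ w))⟩

/-- Fenchel–Moreau: a convex lower semicontinuous function on a compact space `Z`, where convexity
refers to an injection `ℓ` of `Z` into a power of `ℝ`, is the supremum of its affine minorants. -/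
theorem exists_affine_minorant {Z ι : Type*} [TopologicalSpace Z] [CompactSpace Z]
    {ℓ : Z → ι → ℝ} (hℓ : Continuous ℓ) (hinj : Function.Injective ℓ) {F : Z → EReal}
    (hF : LowerSemicontinuous F) (hbot : ∀ z, F z ≠ ⊥)
    (hconv : ∀ z₀ z₁ (t : ℝ), 0 ≤ t → t ≤ 1 → ∃ z, ℓ z = (1 - t) • ℓ z₀ + t • ℓ z₁ ∧
      ∀ a b : ℝ, F z₀ ≤ a → F z₁ ≤ b → F z ≤ (((1 - t) * a + t * b : ℝ) : EReal))
    {z₀ : Z} {r : ℝ} (hr : r < F z₀) :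
    ∃ (φ : (ι → ℝ) →L[ℝ] ℝ) (m : ℝ), r < m + φ (ℓ z₀) ∧
      ∀ z, ((m + φ (ℓ z) : ℝ) : EReal) ≤ F z := by
  obtain ⟨m₀, hm₀⟩ := exists_real_le hF hbot
  by_cases htop : ∀ z, F z = ⊤
  · exact ⟨0, r + 1, by simp, fun z => by simp [htop z]⟩
  push Not at htop
  obtain ⟨z₁, hz₁⟩ := htop
  let epi : Set ((ι → ℝ) × ℝ) := Prod.map ℓ id '' {q : Z × ℝ | F q.1 ≤ q.2}
  have hepi : ∀ {z : Z} {s : ℝ}, F z ≤ s → (ℓ z, s) ∈ epi := fun {z s} h => ⟨(z, s), h, rfl⟩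
  have hclosed : IsClosed epi := by
    have hemb : IsClosedEmbedding (Prod.map ℓ (id : ℝ → ℝ)) :=
      (hℓ.isClosedEmbedding hinj).prodMap IsClosedEmbedding.id
    refine hemb.isClosedMap _ ?_
    exact hF.isClosed_epigraph.preimage
      (continuous_fst.prodMk (continuous_coe_real_ereal.comp continuous_snd) :
        Continuous fun q : Z × ℝ => (q.1, (q.2 : EReal)))
  have hconvex : Convex ℝ epi := by
    rintro _ ⟨⟨x, a⟩, hx, rfl⟩ _ ⟨⟨y, b⟩, hy, rfl⟩ p q hp hq hpq
    obtain ⟨z, hz, hFz⟩ := hconv x y q hq (by linarith)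
    have hp' : p = 1 - q := by linarith
    refine ⟨(z, p * a + q * b), ?_, ?_⟩
    · subst hp'
      exact hFz a b hx hy
    · subst hp'
      ext1
      · exact hz
      · simp
  have hnot : (ℓ z₀, r) ∉ epi := by
    rintro ⟨⟨z, s⟩, hz, h⟩
    simp only [Prod.map_apply, id_eq, Prod.mk.injEq] at h
    obtain ⟨h1, rfl⟩ := h
    rw [hinj h1] at hz
    exact absurd hr (not_lt.2 hz)
  obtain ⟨f, u, hfu, hfe⟩ := geometric_hahn_banach_point_closed hconvex hclosed hnot
  let φ₀ : (ι → ℝ) →L[ℝ] ℝ := f.comp (ContinuousLinearMap.inl ℝ _ _)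
  set β : ℝ := f (0, 1) with hβ
  have hf : ∀ v s, f (v, s) = φ₀ v + s * β := by
    intro v s
    have : ((v, s) : (ι → ℝ) × ℝ) = (v, 0) + s • (0, 1) := by ext <;> simp
    rw [this, map_add, map_smul]
    simp [φ₀, hβ]
  have hdom : ∀ {z : Z} {s : ℝ}, F z ≤ s → u < φ₀ (ℓ z) + s * β := fun h => by
    rw [← hf]
    exact hfe _ (hepi h)
  rw [hf] at hfu
  obtain ⟨a₁, ha₁⟩ : ∃ a : ℝ, F z₁ ≤ a :=
    ⟨(F z₁).toReal, (EReal.coe_toReal hz₁ (hbot z₁)).ge⟩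
  -- The epigraph is stable under increasing the second coordinate.
  have hβ0 : 0 ≤ β := by
    by_contra hneg
    push Not at hneg
    set d := φ₀ (ℓ z₁) + a₁ * β - u with hd
    have hd0 : 0 < d := by linarith [hdom ha₁]
    have h1 : F z₁ ≤ ((a₁ + d / (-β) : ℝ) : EReal) :=
      ha₁.trans (EReal.coe_le_coe_iff.2 (by
        have := div_pos hd0 (neg_pos.2 hneg)
        linarith))
    have h2 := hdom h1
    have h3 : d / (-β) * β = -d := by
      rw [div_neg, neg_mul, div_mul_cancel₀ _ hneg.ne]
    rw [add_mul, h3] at h2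
    linarith
  rcases hβ0.eq_or_lt with hβz | hβpos
    -- The hyperplane is vertical: add a large multiple of it to a constant minorant.
  · rw [← hβz] at hfu hdom
    simp only [mul_zero, add_zero] at hfu hdom
    have hpos : 0 < u - φ₀ (ℓ z₀) := sub_pos.2 hfu
    set k : ℝ := (|r - m₀| + 1) / (u - φ₀ (ℓ z₀)) with hk
    have hk0 : 0 ≤ k := by positivity
    refine ⟨-k • φ₀, m₀ + k * u, ?_, fun z => ?_⟩
    · have : k * (u - φ₀ (ℓ z₀)) = |r - m₀| + 1 := div_mul_cancel₀ _ hpos.ne'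
      have := le_abs_self (r - m₀)
      simp only [smul_apply, smul_eq_mul]
      nlinarith
    · by_cases hz : F z = ⊤
      · simp [hz]
      · refine le_trans (EReal.coe_le_coe_iff.2 ?_) (hm₀ z)
        have := hdom (EReal.coe_toReal hz (hbot z)).ge
        simp only [smul_apply, smul_eq_mul]
        nlinarith
  · refine ⟨-β⁻¹ • φ₀, β⁻¹ * u, ?_, fun z => ?_⟩
    · simp only [smul_apply, smul_eq_mul]
      have : r = β⁻¹ * (r * β) := by field_simp
      have h2 := mul_lt_mul_of_pos_left hfu (inv_pos.2 hβpos)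
      rw [mul_add, ← this] at h2
      linarith
    · by_cases hz : F z = ⊤
      · simp [hz]
      · rw [← EReal.coe_toReal hz (hbot z), EReal.coe_le_coe_iff]
        have h1 := hdom (EReal.coe_toReal hz (hbot z)).ge
        have : (F z).toReal = β⁻¹ * ((F z).toReal * β) := by field_simp
        have h2 := mul_lt_mul_of_pos_left h1 (inv_pos.2 hβpos)
        rw [mul_add, ← this] at h2
        simp only [smul_apply, smul_eq_mul]
        linarith

section Prob

variable {Y : Type*} [TopologicalSpace Y] [CompactSpace Y] [MeasurableSpace Y]

lemma integrable_continuousMap [BorelSpace Y] (σ : ProbabilityMeasure Y) (g : C(Y, ℝ)) :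
    Integrable g (σ : Measure Y) :=
  (BoundedContinuousFunction.mkOfCompact g).integrable _

lemma integral_mix [BorelSpace Y] (t : unitInterval) (σ₀ σ₁ : ProbabilityMeasure Y) (g : C(Y, ℝ)) :
    ∫ y, g y ∂(mix t σ₀ σ₁ : Measure Y) =
      (1 - t) * ∫ y, g y ∂(σ₀ : Measure Y) + t * ∫ y, g y ∂(σ₁ : Measure Y) := by
  change ∫ y, g y ∂(ENNReal.ofReal (1 - (t : ℝ)) • (σ₀ : Measure Y) +
    ENNReal.ofReal (t : ℝ) • (σ₁ : Measure Y)) = _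
  rw [integral_add_measure ((integrable_continuousMap σ₀ g).smul_measure ENNReal.ofReal_ne_top)
    ((integrable_continuousMap σ₁ g).smul_measure ENNReal.ofReal_ne_top), integral_smul_measure,
    integral_smul_measure, ENNReal.toReal_ofReal (sub_nonneg.2 t.2.2), ENNReal.toReal_ofReal t.2.1]
  rfl

lemma eq_of_forall_integral_eq [TopologicalSpace.MetrizableSpace Y] [BorelSpace Y]
    {σ τ : ProbabilityMeasure Y}
    (h : ∀ g : C(Y, ℝ), ∫ y, g y ∂(σ : Measure Y) = ∫ y, g y ∂(τ : Measure Y)) : σ = τ := by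
  apply ProbabilityMeasure.toMeasure_injective
  exact ext_of_forall_integral_eq_of_IsFiniteMeasure fun f => h f.toContinuousMap

lemma continuous_integral (g : C(Y, ℝ)) [BorelSpace Y] :
    Continuous fun σ : ProbabilityMeasure Y => ∫ y, g y ∂(σ : Measure Y) :=
  ProbabilityMeasure.continuous_integral_continuousMap g

lemma integral_sum_mul [BorelSpace Y] {ι : Type*} (s : Finset ι) (α : ι → ℝ) (g : ι → C(Y, ℝ))
    (σ : ProbabilityMeasure Y) :
    ∫ y, (∑ i ∈ s, α i • g i) y ∂(σ : Measure Y) = ∑ i ∈ s, α i * ∫ y, g i y ∂(σ : Measure Y) := by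
  simp_rw [← integral_const_mul]
  rw [← integral_finsetSum _ fun i _ => (integrable_continuousMap σ (g i)).const_mul _]
  simp

lemma mul_add_mul_le_coe {t a b : ℝ} {A B : EReal} (h0 : 0 ≤ t) (h1 : t ≤ 1) (ha : A ≤ a)
    (hb : B ≤ b) :
    ((1 - t : ℝ) : EReal) * A + (t : EReal) * B ≤ (((1 - t) * a + t * b : ℝ) : EReal) := by
  rw [EReal.coe_add, EReal.coe_mul, EReal.coe_mul]
  gcongr

end Prob

variable {X Y : Type*} [TopologicalSpace X] [CompactSpace X] [TopologicalSpace.MetrizableSpace X]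
  [MeasurableSpace X] [BorelSpace X] [TopologicalSpace Y] [CompactSpace Y]
  [TopologicalSpace.MetrizableSpace Y] [MeasurableSpace Y] [BorelSpace Y]

/-- The affine minorants in `exists_affine_minorant` are integrals of pairs of continuous functions:
the additive constant is absorbed since the measures have mass one. -/
theorem exists_pair_minorant {T : ProbabilityMeasure X → ProbabilityMeasure Y → EReal}
    (hT : LowerSemicontinuous (Function.uncurry T)) (hbot : ∀ μ ν, T μ ν ≠ ⊥)
    (hconv : JointlyConvex T) {μ₀ : ProbabilityMeasure X} {ν₀ : ProbabilityMeasure Y} {r : ℝ}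
    (hr : r < T μ₀ ν₀) :
    ∃ (f : C(X, ℝ)) (g : C(Y, ℝ)),
      r < ∫ x, f x ∂(μ₀ : Measure X) + ∫ y, g y ∂(ν₀ : Measure Y) ∧
      ∀ (μ : ProbabilityMeasure X) (ν : ProbabilityMeasure Y),
        ((∫ x, f x ∂(μ : Measure X) + ∫ y, g y ∂(ν : Measure Y) : ℝ) : EReal) ≤ T μ ν := by
  classical
  let ℓ : ProbabilityMeasure X × ProbabilityMeasure Y → C(X, ℝ) ⊕ C(Y, ℝ) → ℝ := fun p =>
    Sum.elim (fun f => ∫ x, f x ∂(p.1 : Measure X)) (fun g => ∫ y, g y ∂(p.2 : Measure Y))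
  have hℓ : Continuous ℓ := continuous_pi fun i => by
    cases i with
    | inl f => exact (continuous_integral f).comp continuous_fst
    | inr g => exact (continuous_integral g).comp continuous_snd
  have hinj : Function.Injective ℓ := fun p q h => Prod.ext
    (eq_of_forall_integral_eq fun f => congrFun h (Sum.inl f))
    (eq_of_forall_integral_eq fun g => congrFun h (Sum.inr g))
  obtain ⟨φ, m, h1, h2⟩ := exists_affine_minorant hℓ hinj hT (fun p => hbot p.1 p.2)
    (fun p q t h0 h1 => ⟨(mix ⟨t, h0, h1⟩ p.1 q.1, mix ⟨t, h0, h1⟩ p.2 q.2), by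
      ext i
      cases i with
      | inl f => exact integral_mix _ _ _ f
      | inr g => exact integral_mix _ _ _ g, fun a b ha hb =>
        (hconv ⟨t, h0, h1⟩ p.1 q.1 p.2 q.2).trans (mul_add_mul_le_coe h0 h1 ha hb)⟩)
    (z₀ := (μ₀, ν₀)) hr
  obtain ⟨s, hs⟩ := exists_finset_forall_eq_sum φ
  let f : C(X, ℝ) := ContinuousMap.const X m +
    ∑ i ∈ s, φ (Pi.single i 1) • Sum.elim id (fun _ => (0 : C(X, ℝ))) i
  let g : C(Y, ℝ) := ∑ i ∈ s, φ (Pi.single i 1) • Sum.elim (fun _ => (0 : C(Y, ℝ))) id i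
  have key : ∀ (μ : ProbabilityMeasure X) (ν : ProbabilityMeasure Y),
      ∫ x, f x ∂(μ : Measure X) + ∫ y, g y ∂(ν : Measure Y) = m + φ (ℓ (μ, ν)) := by
    intro μ ν
    have hf : ∫ x, f x ∂(μ : Measure X) =
        m + ∑ i ∈ s, φ (Pi.single i 1) *
          ∫ x, Sum.elim id (fun _ => (0 : C(X, ℝ))) i x ∂(μ : Measure X) := by
      rw [← integral_sum_mul]
      simp only [f, ContinuousMap.add_apply]
      rw [integral_add (integrable_continuousMap μ _) (integrable_continuousMap μ _)]
      simp
    rw [hf, integral_sum_mul, hs, add_assoc, ← Finset.sum_add_distrib]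
    congr 1
    refine Finset.sum_congr rfl fun i _ => ?_
    cases i <;> simp [ℓ]
  refine ⟨f, g, by rw [key]; exact h1, fun μ ν => by rw [key]; exact h2 (μ, ν)⟩

theorem exists_function_minorant {F : ProbabilityMeasure Y → EReal} (hF : LowerSemicontinuous F)
    (hbot : ∀ ν, F ν ≠ ⊥) (hconv : ConvexOnProb F) {ν₀ : ProbabilityMeasure Y} {r : ℝ}
    (hr : r < F ν₀) :
    ∃ g : C(Y, ℝ), r < ∫ y, g y ∂(ν₀ : Measure Y) ∧
      ∀ ν : ProbabilityMeasure Y, ((∫ y, g y ∂(ν : Measure Y) : ℝ) : EReal) ≤ F ν := by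
  obtain ⟨f, g, h1, h2⟩ := exists_pair_minorant (X := Y) (T := fun _ ν => F ν) (μ₀ := ν₀)
    (hF.comp continuous_snd) (fun _ => hbot) (fun t _ _ σ₀ σ₁ => hconv t σ₀ σ₁) hr
  refine ⟨ContinuousMap.const Y (∫ x, f x ∂(ν₀ : Measure Y)) + g, ?_, fun ν => ?_⟩
  · simp only [ContinuousMap.add_apply]
    rw [integral_add (integrable_continuousMap _ _) (integrable_continuousMap _ _)]
    simpa using h1
  · simp only [ContinuousMap.add_apply]
    rw [integral_add (integrable_continuousMap _ _) (integrable_continuousMap _ _)]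
    simpa using h2 ν₀ ν

end FenchelMoreau

/-! ### A theorem of the alternative for continuous functions -/

/-- A theorem of the alternative: if no function of a convex set `𝒞` of
continuous functions on a compact space is positive everywhere, then some probability measure gives
every function of `𝒞` a nonpositive integral. The measure is obtained by separating `𝒞` from the
open cone of positive functions and representing the separating functional. -/
theorem exists_prob_integral_nonpos {W : Type*} [TopologicalSpace W] [CompactSpace W] [T2Space W]
    [MeasurableSpace W] [BorelSpace W] {𝒞 : Set C(W, ℝ)} (hne : 𝒞.Nonempty) (hconv : Convex ℝ 𝒞)
    (h𝒞 : ∀ h ∈ 𝒞, ∃ w, h w ≤ 0) :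
    ∃ π : ProbabilityMeasure W, ∀ h ∈ 𝒞, ∫ w, h w ∂(π : Measure W) ≤ 0 := by
  obtain ⟨h₀, hh₀⟩ := hne
  obtain ⟨w₀, -⟩ := h𝒞 h₀ hh₀
  let P : Set C(W, ℝ) := {h | ∀ w, 0 < h w}
  have hPo : IsOpen P := by
    have : P = {h : C(W, ℝ) | Set.MapsTo h Set.univ (Set.Ioi 0)} := by
      ext h
      simp [P, Set.MapsTo]
    rw [this]
    exact ContinuousMap.isOpen_setOfPred_mapsTo isCompact_univ isOpen_Ioi
  have hPc : Convex ℝ P := by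
    intro f hf g hg a b ha hb hab w
    simp only [ContinuousMap.add_apply, ContinuousMap.smul_apply, smul_eq_mul]
    rcases ha.eq_or_lt with rfl | ha
    · rw [zero_add] at hab
      simpa [hab] using hg w
    · exact add_pos_of_pos_of_nonneg (mul_pos ha (hf w)) (mul_nonneg hb (hg w).le)
  have hdisj : Disjoint P 𝒞 := Set.disjoint_left.2 fun h hP h𝒞' => by
    obtain ⟨w, hw⟩ := h𝒞 h h𝒞'
    exact absurd (hP w) (not_lt.2 hw)
  obtain ⟨φ, u, hφP, hφ𝒞⟩ := geometric_hahn_banach_open hPc hPo hconv hdisj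
  -- `P` is a cone, so a functional bounded above on it is nonpositive there.
  have hφnonpos : ∀ p ∈ P, φ p ≤ 0 := by
    intro p hp
    by_contra hpos
    push Not at hpos
    have hk : 0 < (|u| + 1) / φ p := by positivity
    have h1 := hφP (((|u| + 1) / φ p) • p) fun w => by
      simpa using mul_pos hk (hp w)
    rw [map_smul, smul_eq_mul, div_mul_cancel₀ _ hpos.ne'] at h1
    linarith [le_abs_self u]
  have hu : 0 ≤ u := by
    by_contra hneg
    push Not at hneg
    have h1 : ∀ ε : ℝ, 0 < ε → ε * φ 1 < u := fun ε hε => by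
      have := hφP (ε • (1 : C(W, ℝ))) fun w => by simpa using hε
      simpa using this
    have h2 := hφnonpos 1 fun w => by simp
    have h3 := h1 (-u / (1 - φ 1)) (div_pos (neg_pos.2 hneg) (by linarith))
    have h4 : -u / (1 - φ 1) * (1 - φ 1) = -u := div_mul_cancel₀ _ (by linarith)
    have h5 : 0 < -u / (1 - φ 1) := div_pos (neg_pos.2 hneg) (by linarith)
    nlinarith
  have hφ1 : φ 1 < 0 := by
    refine lt_of_le_of_ne (hφnonpos 1 fun w => by simp) fun h0 => ?_
    -- If `φ 1 = 0` then `φ h₀ ≤ φ (h₀ + C) ≤ 0` for large `C`, and likewise for `-h₀`.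
    have hzero : ∀ h : C(W, ℝ), φ h ≤ 0 := fun h => by
      have := hφnonpos (h + (‖h‖ + 1) • (1 : C(W, ℝ))) fun w => by
        have := neg_le_of_abs_le (h.norm_coe_le_norm w)
        simp only [ContinuousMap.add_apply, ContinuousMap.smul_apply, ContinuousMap.one_apply,
          smul_eq_mul, mul_one]
        linarith
      simpa [h0] using this
    have h1 := hφP 1 fun w => by simp
    have h2 := hφ𝒞 h₀ hh₀
    linarith [hzero h₀]
  -- Normalize `φ` to a positive functional of mass one; then `h ∈ 𝒞` gives `φ h ≥ u ≥ 0`, that is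
  -- `Λ h ≤ 0`.
  let Λ : CompactlySupportedContinuousMap W ℝ →ₚ[ℝ] ℝ :=
    { toFun := fun h => (φ 1)⁻¹ * φ h.toContinuousMap
      map_add' := fun f g => by
        have : (f + g).toContinuousMap = f.toContinuousMap + g.toContinuousMap := rfl
        rw [this, map_add, mul_add]
      map_smul' := fun c f => by
        have : (c • f).toContinuousMap = c • f.toContinuousMap := rfl
        rw [this, map_smul, smul_eq_mul, RingHom.id_apply, smul_eq_mul]
        ring
      monotone' := fun f g hfg => by
        have hsub : φ (g.toContinuousMap - f.toContinuousMap) ≤ 0 := by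
          refine le_of_forall_pos_lt_add fun ε hε => ?_
          have hδ : 0 < ε / (2 * -φ 1) := div_pos hε (by linarith)
          have := hφnonpos (g.toContinuousMap - f.toContinuousMap +
              (ε / (2 * -φ 1)) • (1 : C(W, ℝ))) fun w => by
            have : f w ≤ g w := hfg w
            simp only [ContinuousMap.add_apply, ContinuousMap.sub_apply, ContinuousMap.smul_apply,
              ContinuousMap.one_apply, smul_eq_mul, mul_one]
            exact add_pos_of_nonneg_of_pos (sub_nonneg.2 this) hδ
          rw [map_add, map_smul, smul_eq_mul] at this
          have h4 : ε / (2 * -φ 1) * φ 1 = -(ε / 2) := by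
            have : φ 1 ≠ 0 := hφ1.ne
            field_simp
          linarith
        rw [map_sub] at hsub
        exact mul_le_mul_of_nonpos_left (by linarith) (inv_nonpos.2 hφ1.le) }
  have hΛ : ∀ h : C(W, ℝ), ∫ w, h w ∂(RealRMK.rieszMeasure Λ) = (φ 1)⁻¹ * φ h := fun h =>
    RealRMK.integral_rieszMeasure Λ ⟨h, HasCompactSupport.of_compactSpace _⟩
  have hfin : IsFiniteMeasure (RealRMK.rieszMeasure Λ) := ⟨isCompact_univ.measure_lt_top⟩
  have hprob : IsProbabilityMeasure (RealRMK.rieszMeasure Λ) := by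
    have h1 := hΛ 1
    rw [inv_mul_cancel₀ hφ1.ne] at h1
    simp only [ContinuousMap.one_apply, integral_const, smul_eq_mul, mul_one] at h1
    exact ⟨(ENNReal.toReal_eq_one_iff _).1 h1⟩
  refine ⟨⟨RealRMK.rieszMeasure Λ, hprob⟩, fun h hh => ?_⟩
  refine (hΛ h).trans_le ?_
  exact mul_nonpos_of_nonpos_of_nonneg (inv_nonpos.2 hφ1.le) (hu.trans (hφ𝒞 h hh))

/-! ### Integrals of extended-real-valued functions -/

section ERealIntegral

variable {Ω : Type*} [MeasurableSpace Ω] {μ : Measure Ω}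

lemma coe_integral_eq_sub {u : Ω → ℝ} (hu : Integrable u μ) :
    ((∫ x, u x ∂μ : ℝ) : EReal) =
      ((∫⁻ x, ENNReal.ofReal (u x) ∂μ : ENNReal) : EReal) -
        ((∫⁻ x, ENNReal.ofReal (-u x) ∂μ : ENNReal) : EReal) := by
  rw [integral_eq_lintegral_pos_part_sub_lintegral_neg_part hu, EReal.coe_sub,
    EReal.coe_ennreal_toReal hu.lintegral_lt_top.ne, EReal.coe_ennreal_toReal]
  exact hu.neg.lintegral_lt_top.ne

lemma toENNReal_coe_real (a : ℝ) : (a : EReal).toENNReal = ENNReal.ofReal a := by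
  rw [EReal.toENNReal_of_ne_top (EReal.coe_ne_top a), EReal.toReal_coe]

/-- No measurability of `f` is needed. -/
lemma coe_integral_le_erealIntegral {u : Ω → ℝ} {f : Ω → EReal} (hu : Integrable u μ)
    (h : ∀ x, (u x : EReal) ≤ f x) : ((∫ x, u x ∂μ : ℝ) : EReal) ≤ erealIntegral μ f := by
  rw [coe_integral_eq_sub hu]
  refine EReal.sub_le_sub ?_ ?_
  · refine EReal.coe_ennreal_le_coe_ennreal_iff.2 (lintegral_mono fun x => ?_)
    rw [← toENNReal_coe_real]
    exact EReal.toENNReal_le_toENNReal (h x)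
  · refine EReal.coe_ennreal_le_coe_ennreal_iff.2 (lintegral_mono fun x => ?_)
    rw [← toENNReal_coe_real, EReal.coe_neg]
    exact EReal.toENNReal_le_toENNReal (EReal.neg_le_neg_iff.2 (h x))

/-- Monotone convergence for `erealIntegral`. -/
lemma erealIntegral_le_of_monotone {u : ℕ → Ω → ℝ} {f : Ω → EReal} {r : ℝ}
    (hint : ∀ n, Integrable (u n) μ) (hmono : ∀ x, Monotone fun n => u n x)
    (hsup : ∀ x, f x = ⨆ n, (u n x : EReal)) (hr : ∀ n, ∫ x, u n x ∂μ ≤ r) :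
    erealIntegral μ f ≤ r := by
  have hlim : ∀ x, Tendsto (fun n => (u n x : EReal)) atTop (𝓝 (f x)) := fun x => by
    rw [hsup x]
    exact tendsto_atTop_iSup fun i j hij => EReal.coe_le_coe_iff.2 (hmono x hij)
  have hpos : Tendsto (fun n => ∫⁻ x, ENNReal.ofReal (u n x) ∂μ) atTop
      (𝓝 (∫⁻ x, (f x).toENNReal ∂μ)) := by
    refine lintegral_tendsto_of_tendsto_of_monotone
      (fun n => (hint n).1.aemeasurable.ennreal_ofReal)
      (ae_of_all _ fun x i j hij => ENNReal.ofReal_le_ofReal (hmono x hij))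
      (ae_of_all _ fun x => ?_)
    simp_rw [← toENNReal_coe_real]
    exact (EReal.continuous_toENNReal.tendsto _).comp (hlim x)
  have hneg : Tendsto (fun n => ∫⁻ x, ENNReal.ofReal (-u n x) ∂μ) atTop
      (𝓝 (∫⁻ x, (-f x).toENNReal ∂μ)) := by
    refine lintegral_tendsto_of_tendsto_of_antitone
      (fun n => (hint n).1.aemeasurable.neg.ennreal_ofReal)
      (ae_of_all _ fun x i j hij => ENNReal.ofReal_le_ofReal (neg_le_neg (hmono x hij)))
      (hint 0).neg.lintegral_lt_top.ne (ae_of_all _ fun x => ?_)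
    simp_rw [← toENNReal_coe_real, EReal.coe_neg]
    exact (EReal.continuous_toENNReal.tendsto _).comp ((continuous_neg.tendsto _).comp (hlim x))
  have hfin : ∫⁻ x, (-f x).toENNReal ∂μ ≠ ⊤ := by
    refine ((lintegral_mono fun x => ?_).trans_lt (hint 0).neg.lintegral_lt_top).ne
    rw [← toENNReal_coe_real, Pi.neg_apply, EReal.coe_neg]
    refine EReal.toENNReal_le_toENNReal (EReal.neg_le_neg_iff.2 ?_)
    rw [hsup x]
    exact le_iSup (fun n => (u n x : EReal)) 0
  refine EReal.sub_le_of_le_add ?_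
  have hpos' := (continuous_coe_ennreal_ereal.tendsto _).comp hpos
  have hneg' := (continuous_coe_ennreal_ereal.tendsto _).comp hneg
  have hadd : Tendsto
      (fun n => (r : EReal) + ((∫⁻ x, ENNReal.ofReal (-u n x) ∂μ : ENNReal) : EReal)) atTop
      (𝓝 ((r : EReal) + ((∫⁻ x, (-f x).toENNReal ∂μ : ENNReal) : EReal))) := by
    have := (EReal.continuousAt_add
      (p := ((r : EReal), ((∫⁻ x, (-f x).toENNReal ∂μ : ENNReal) : EReal)))
      (Or.inl (EReal.coe_ne_top r)) (Or.inl (EReal.coe_ne_bot r))).tendsto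
    exact this.comp ((tendsto_const_nhds (x := (r : EReal))).prodMk_nhds hneg')
  refine le_of_tendsto_of_tendsto' hpos' hadd fun n => ?_
  have h1 : ((∫ x, u n x ∂μ : ℝ) : EReal) ≤ r := EReal.coe_le_coe_iff.2 (hr n)
  rw [coe_integral_eq_sub (hint n)] at h1
  refine (EReal.sub_le_iff_le_add (Or.inl ?_) (Or.inl ?_)).1 h1
  · exact EReal.coe_ennreal_ne_bot _
  · exact EReal.coe_ennreal_eq_top_iff.not.2 (hint n).neg.lintegral_lt_top.ne

end ERealIntegral

/-! ### Dual pairs of a cost -/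

lemma coe_combo_le {a b p q : ℝ} {E : EReal} (ha : 0 ≤ a) (hb : 0 ≤ b) (hab : a + b = 1)
    (hp : (p : EReal) ≤ E) (hq : (q : EReal) ≤ E) : ((a * p + b * q : ℝ) : EReal) ≤ E := by
  refine le_trans (EReal.coe_le_coe_iff.2 (Convex.combo_le_max p q ha hb hab)) ?_
  rcases max_cases p q with h | h <;> rw [h.1] <;> assumption

/-- The dual class of a cost `c`: pairs `(f, g)` of continuous functions such that
`f x + ∫ g dσ ≤ c x σ` for all `x` and `σ`. -/
def dualPairs {X Y : Type*} [TopologicalSpace X] [TopologicalSpace Y] [MeasurableSpace Y]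
    (c : X → ProbabilityMeasure Y → EReal) : Set (C(X, ℝ) × C(Y, ℝ)) :=
  {p | ∀ x (σ : ProbabilityMeasure Y),
    ((p.1 x + ∫ y, p.2 y ∂(σ : Measure Y) : ℝ) : EReal) ≤ c x σ}

section

variable {X Y : Type*} [TopologicalSpace X] [CompactSpace X] [TopologicalSpace.MetrizableSpace X]
  [TopologicalSpace Y] [CompactSpace Y] [TopologicalSpace.MetrizableSpace Y]
  [MeasurableSpace Y] [BorelSpace Y] {c : X → ProbabilityMeasure Y → EReal}

lemma abs_integral_le_norm (σ : ProbabilityMeasure Y) (g : C(Y, ℝ)) :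
    |∫ y, g y ∂(σ : Measure Y)| ≤ ‖g‖ := by
  simpa using norm_integral_le_of_norm_le_const (μ := (σ : Measure Y))
    (ae_of_all _ fun y => g.norm_coe_le_norm y)

/-- The condition on `g` at the single point `x₀` extends to a neighbourhood by compactness of
`P(Y)`; away from it, `f` is lowered below the minimum of `c` by a bump function. -/
theorem exists_mem_dualPairs (hc : LowerSemicontinuous (Function.uncurry c))
    (hbot : ∀ x σ, c x σ ≠ ⊥) {g : C(Y, ℝ)} {x₀ : X} {a : ℝ}
    (h : ∀ σ : ProbabilityMeasure Y, ((a + ∫ y, g y ∂(σ : Measure Y) : ℝ) : EReal) < c x₀ σ) :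
    ∃ f : C(X, ℝ), f x₀ = a ∧ (f, g) ∈ dualPairs c := by
  obtain ⟨m, hm⟩ := exists_real_le hc fun p => hbot p.1 p.2
  have hopen : IsOpen {p : X × ProbabilityMeasure Y |
      ((a + ∫ y, g y ∂(p.2 : Measure Y) : ℝ) : EReal) < c p.1 p.2} := by
    have hcont : Continuous fun p : X × ProbabilityMeasure Y => a + ∫ y, g y ∂(p.2 : Measure Y) :=
      continuous_const.add ((continuous_integral g).comp continuous_snd)
    rw [isOpen_iff_mem_nhds]
    intro p hp
    obtain ⟨b, hb1, hb2⟩ := EReal.lt_iff_exists_real_btwn.1 hp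
    filter_upwards [hc p _ hb2, hcont.continuousAt.eventually_lt continuousAt_const
      (EReal.coe_lt_coe_iff.1 hb1)] with q hq1 hq2
    exact (EReal.coe_lt_coe_iff.2 hq2).trans hq1
  obtain ⟨U, V, hU, -, hxU, hV, hUV⟩ := generalized_tube_lemma (isCompact_singleton (x := x₀))
    (isCompact_univ (X := ProbabilityMeasure Y)) hopen (by
      rintro ⟨x, σ⟩ ⟨hx, -⟩
      obtain rfl : x = x₀ := hx
      exact h σ)
  obtain ⟨b, hb0, hb1, hb⟩ := exists_continuous_zero_one_of_isClosed
    (isClosed_singleton (x := x₀)) hU.isClosed_compl (by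
      rw [Set.disjoint_compl_right_iff_subset]
      exact hxU)
  set M : ℝ := |a| + ‖g‖ + |m| with hM
  have hM0 : 0 ≤ M := by positivity
  refine ⟨ContinuousMap.const X a - M • b, ?_, fun x σ => ?_⟩
  · have := hb0 (Set.mem_singleton x₀)
    simp [this]
  · simp only [ContinuousMap.sub_apply, ContinuousMap.const_apply, ContinuousMap.smul_apply,
      smul_eq_mul]
    by_cases hx : x ∈ U
    · refine le_trans (EReal.coe_le_coe_iff.2 ?_) (hUV (Set.mk_mem_prod hx (hV trivial)) : _ < _).le
      have := mul_nonneg hM0 (hb x).1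
      simp only
      linarith
    · refine le_trans (EReal.coe_le_coe_iff.2 ?_) (hm (x, σ))
      have hbx : b x = 1 := hb1 hx
      rw [hbx, hM]
      linarith [le_abs_self a, neg_abs_le m, (abs_le.1 (abs_integral_le_norm σ g)).2]

/-- A convex lower semicontinuous cost is the supremum of its dual pairs. -/
theorem exists_mem_dualPairs_lt (hc : LowerSemicontinuous (Function.uncurry c))
    (hbot : ∀ x σ, c x σ ≠ ⊥) (hconv : ∀ x, ConvexOnProb (c x)) {x : X}
    {σ : ProbabilityMeasure Y} {r : ℝ} (hr : r < c x σ) :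
    ∃ p ∈ dualPairs c, r < p.1 x + ∫ y, p.2 y ∂(σ : Measure Y) := by
  obtain ⟨g, hg, hgle⟩ := exists_function_minorant
    (hc.comp (Continuous.prodMk_right x) : LowerSemicontinuous (c x)) (hbot x) (hconv x) hr
  set ε := (∫ y, g y ∂(σ : Measure Y) - r) / 2 with hε
  have hε0 : 0 < ε := by linarith
  obtain ⟨f, hf, hfg⟩ := exists_mem_dualPairs (a := -ε) hc hbot (g := g) (x₀ := x) fun τ =>
    lt_of_lt_of_le (EReal.coe_lt_coe_iff.2 (by linarith)) (hgle τ)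
  exact ⟨(f, g), hfg, by simp only [hf]; linarith⟩

lemma dualPairs_nonempty (hc : LowerSemicontinuous (Function.uncurry c))
    (hbot : ∀ x σ, c x σ ≠ ⊥) : (dualPairs c).Nonempty := by
  obtain ⟨m, hm⟩ := exists_real_le hc fun p => hbot p.1 p.2
  exact ⟨(ContinuousMap.const X m, 0), fun x σ => by simpa using hm (x, σ)⟩

lemma convex_dualPairs : Convex ℝ (dualPairs c) := by
  rintro p hp q hq a b ha hb hab x σ
  have key : (a • p + b • q).1 x + ∫ y, (a • p + b • q).2 y ∂(σ : Measure Y) =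
      a * (p.1 x + ∫ y, p.2 y ∂(σ : Measure Y)) + b * (q.1 x + ∫ y, q.2 y ∂(σ : Measure Y)) := by
    simp only [Prod.fst_add, Prod.smul_fst, Prod.snd_add, Prod.smul_snd, ContinuousMap.add_apply,
      ContinuousMap.smul_apply, smul_eq_mul]
    rw [integral_add ((integrable_continuousMap σ p.2).const_mul a)
      ((integrable_continuousMap σ q.2).const_mul b), integral_const_mul, integral_const_mul]
    ring
  rw [key]
  exact coe_combo_le ha hb hab (hp x σ) (hq x σ)

lemma continuous_integral_right (σ : ProbabilityMeasure Y) :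
    Continuous fun g : C(Y, ℝ) => ∫ y, g y ∂(σ : Measure Y) := by
  refine (LipschitzWith.of_dist_le_mul (K := 1) fun g h => ?_).continuous
  rw [Real.dist_eq, ← integral_sub (integrable_continuousMap σ g) (integrable_continuousMap σ h),
    NNReal.coe_one, one_mul, dist_eq_norm]
  exact abs_integral_le_norm σ (g - h)

/-- Separability of `C(X) × C(Y)` makes a countable family of dual pairs sufficient. -/
theorem exists_seq_dualPairs (hc : LowerSemicontinuous (Function.uncurry c))
    (hbot : ∀ x σ, c x σ ≠ ⊥) (hconv : ∀ x, ConvexOnProb (c x)) :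
    ∃ p : ℕ → C(X, ℝ) × C(Y, ℝ), (∀ n, p n ∈ dualPairs c) ∧ ∀ x (σ : ProbabilityMeasure Y),
      c x σ = ⨆ n, (((p n).1 x + ∫ y, (p n).2 y ∂(σ : Measure Y) : ℝ) : EReal) := by
  have : Nonempty (dualPairs c) := (dualPairs_nonempty hc hbot).to_subtype
  let _ := TopologicalSpace.metrizableSpaceMetric X
  let _ := TopologicalSpace.metrizableSpaceMetric Y
  let d := TopologicalSpace.denseSeq (dualPairs c)
  refine ⟨fun n => d n, fun n => (d n).2, fun x σ => le_antisymm ?_ ?_⟩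
  · refine le_of_forall_lt fun r hr => ?_
    obtain ⟨r', hr1, hr2⟩ := EReal.lt_iff_exists_real_btwn.1 hr
    obtain ⟨p, hp, hlt⟩ := exists_mem_dualPairs_lt hc hbot hconv hr2
    have hcont : Continuous fun q : dualPairs c =>
        q.1.1 x + ∫ y, q.1.2 y ∂(σ : Measure Y) :=
      ((continuous_eval_const x).comp (continuous_fst.comp continuous_subtype_val)).add
        ((continuous_integral_right σ).comp (continuous_snd.comp continuous_subtype_val))
    obtain ⟨n, hn⟩ := (TopologicalSpace.denseRange_denseSeq (dualPairs c)).exists_mem_open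
      (isOpen_lt continuous_const hcont) ⟨⟨p, hp⟩, hlt⟩
    refine hr1.trans (lt_of_lt_of_le (EReal.coe_lt_coe_iff.2 hn) ?_)
    exact le_iSup (fun n => (((d n).1.1 x + ∫ y, (d n).1.2 y ∂(σ : Measure Y) : ℝ) : EReal)) n
  · exact iSup_le fun n => (d n).2 x σ

end

section Disintegration

variable {X Y : Type*} [MeasurableSpace X] [TopologicalSpace Y] [CompactSpace Y]
  [MeasurableSpace Y] [BorelSpace Y]
  {μ : ProbabilityMeasure X} {ν : ProbabilityMeasure Y} {π : ProbabilityMeasure (X × Y)}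
  {κ : Kernel X Y} [IsMarkovKernel κ]

lemma integrable_integral_kernel (μ : ProbabilityMeasure X) (κ : Kernel X Y) [IsMarkovKernel κ]
    (g : C(Y, ℝ)) : Integrable (fun x => ∫ y, g y ∂κ x) (μ : Measure X) := by
  refine Integrable.of_bound (C := ‖g‖) ?_ (ae_of_all _ fun x => ?_)
  · exact (g.continuous.stronglyMeasurable.integral_kernel).aestronglyMeasurable
  · simpa using norm_integral_le_of_norm_le_const (μ := κ x)
      (ae_of_all _ fun y => g.norm_coe_le_norm y)

lemma integral_snd_marginal (hπ : π ∈ couplings μ ν) (hκ : IsDisintegration κ μ π) (g : C(Y, ℝ)) :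
    ∫ y, g y ∂(ν : Measure Y) = ∫ x, ∫ y, g y ∂κ x ∂(μ : Measure X) := by
  have hint : Integrable (fun z : X × Y => g z.2) (π : Measure (X × Y)) :=
    Integrable.of_bound (C := ‖g‖)
      (g.continuous.stronglyMeasurable.comp_measurable measurable_snd).aestronglyMeasurable
      (ae_of_all _ fun z => g.norm_coe_le_norm z.2)
  rw [← hπ.2, Measure.snd, integral_map measurable_snd.aemeasurable
    g.continuous.aestronglyMeasurable]
  rw [IsDisintegration] at hκ
  rw [hκ] at hint ⊢
  exact Measure.integral_compProd hint

end Disintegration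

/-! ### Optimal plans -/

section Plans

variable {X Y : Type*} [TopologicalSpace X] [CompactSpace X] [TopologicalSpace.MetrizableSpace X]
  [MeasurableSpace X] [BorelSpace X] [TopologicalSpace Y] [CompactSpace Y]
  [TopologicalSpace.MetrizableSpace Y] [MeasurableSpace Y] [BorelSpace Y]
  {c : X → ProbabilityMeasure Y → EReal}
  {μ : ProbabilityMeasure X} {ν : ProbabilityMeasure Y} {π : ProbabilityMeasure (X × Y)}

/-- Continuous functions `Ψ` on `X × Y` with `∫ Ψ(x, ·) dσ ≤ c x σ` for all `x` and `σ`. -/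
def subcosts (c : X → ProbabilityMeasure Y → EReal) : Set C(X × Y, ℝ) :=
  {Ψ | ∀ x (σ : ProbabilityMeasure Y), ((∫ y, Ψ (x, y) ∂(σ : Measure Y) : ℝ) : EReal) ≤ c x σ}

lemma integrable_slice (Ψ : C(X × Y, ℝ)) (x : X) (σ : ProbabilityMeasure Y) :
    Integrable (fun y => Ψ (x, y)) (σ : Measure Y) :=
  integrable_continuousMap σ (Ψ.comp ⟨fun y => (x, y), by fun_prop⟩)

lemma integral_combo_slice (Ψ₁ Ψ₂ : C(X × Y, ℝ)) (a b : ℝ) (x : X) (σ : ProbabilityMeasure Y) :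
    ∫ y, (a * Ψ₁ (x, y) + b * Ψ₂ (x, y)) ∂(σ : Measure Y) =
      a * ∫ y, Ψ₁ (x, y) ∂(σ : Measure Y) + b * ∫ y, Ψ₂ (x, y) ∂(σ : Measure Y) := by
  rw [integral_add ((integrable_slice Ψ₁ x σ).const_mul a) ((integrable_slice Ψ₂ x σ).const_mul b),
    integral_const_mul, integral_const_mul]

/-- The function `(x, y) ↦ f x + g y`. -/
def directSum (f : C(X, ℝ)) (g : C(Y, ℝ)) : C(X × Y, ℝ) :=
  f.comp ContinuousMap.fst + g.comp ContinuousMap.snd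

lemma integral_directSum_slice (f : C(X, ℝ)) (g : C(Y, ℝ)) (x : X) (σ : ProbabilityMeasure Y) :
    ∫ y, directSum f g (x, y) ∂(σ : Measure Y) = f x + ∫ y, g y ∂(σ : Measure Y) := by
  simp only [directSum, ContinuousMap.add_apply, ContinuousMap.comp_apply, ContinuousMap.fst_apply,
    ContinuousMap.snd_apply]
  rw [integral_add (integrable_const _) (integrable_continuousMap σ g)]
  simp

lemma directSum_mem_subcosts {p : C(X, ℝ) × C(Y, ℝ)} (hp : p ∈ dualPairs c) :
    directSum p.1 p.2 ∈ subcosts c := fun x σ => by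
  rw [integral_directSum_slice]
  exact hp x σ

/-- The class of subcosts is stable under mixing with continuous weights in `x`. -/
lemma weighted_mem_subcosts {Ψ₁ Ψ₂ : C(X × Y, ℝ)} (h₁ : Ψ₁ ∈ subcosts c) (h₂ : Ψ₂ ∈ subcosts c)
    {w : C(X, ℝ)} (h0 : ∀ x, 0 ≤ w x) (h1 : ∀ x, w x ≤ 1) :
    w.comp ContinuousMap.fst * Ψ₁ + (1 - w.comp ContinuousMap.fst) * Ψ₂ ∈ subcosts c := by
  intro x σ
  have := integral_combo_slice Ψ₁ Ψ₂ (w x) (1 - w x) x σ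
  simp only [ContinuousMap.add_apply, ContinuousMap.mul_apply, ContinuousMap.comp_apply,
    ContinuousMap.sub_apply, ContinuousMap.one_apply, ContinuousMap.fst_apply]
  rw [this]
  exact coe_combo_le (h0 x) (sub_nonneg.2 (h1 x)) (by ring) (h₁ x σ) (h₂ x σ)

lemma borelSpace_prod : BorelSpace (X × Y) := by
  let _ := TopologicalSpace.metrizableSpaceMetric X
  let _ := TopologicalSpace.metrizableSpaceMetric Y
  infer_instance

/-- If `r` bounds the dual problem, some plan in `K(μ, ν)` has `∫ Ψ dπ ≤ r` for every subcost `Ψ`.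
Otherwise some subcost would, up to a sum `f x + g y` with zero integral against every plan in
`K(μ, ν)`, exceed `r` everywhere, and this gives a dual pair of value larger than `r`. -/
theorem exists_plan_integral_le (hc : LowerSemicontinuous (Function.uncurry c))
    (hbot : ∀ x σ, c x σ ≠ ⊥) {r : ℝ}
    (hr : ∀ p ∈ dualPairs c,
      ∫ x, p.1 x ∂(μ : Measure X) + ∫ y, p.2 y ∂(ν : Measure Y) ≤ r) :
    ∃ π ∈ couplings μ ν, ∀ Ψ ∈ subcosts c, ∫ z, Ψ z ∂(π : Measure (X × Y)) ≤ r := by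
  have hB : BorelSpace (X × Y) := borelSpace_prod
  let 𝒞 : Set C(X × Y, ℝ) := {h | ∃ Ψ ∈ subcosts c, ∃ (f : C(X, ℝ)) (g : C(Y, ℝ)), ∀ z,
    h z = Ψ z + f z.1 + g z.2 -
      (∫ x, f x ∂(μ : Measure X) + ∫ y, g y ∂(ν : Measure Y) + r)}
  obtain ⟨p₀, hp₀⟩ := dualPairs_nonempty hc hbot
  have hΨ₀ := directSum_mem_subcosts hp₀
  set Ψ₀ := directSum p₀.1 p₀.2
  have mem𝒞 : ∀ Ψ ∈ subcosts c, ∀ (f : C(X, ℝ)) (g : C(Y, ℝ)), Ψ + directSum f g -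
      ContinuousMap.const (X × Y)
        (∫ x, f x ∂(μ : Measure X) + ∫ y, g y ∂(ν : Measure Y) + r) ∈ 𝒞 :=
    fun Ψ hΨ f g => ⟨Ψ, hΨ, f, g, fun z => by simp [directSum]; ring⟩
  have hne : 𝒞.Nonempty := ⟨_, mem𝒞 Ψ₀ hΨ₀ 0 0⟩
  have hconv : Convex ℝ 𝒞 := by
    rintro h ⟨Ψ, hΨ, f, g, hh⟩ h' ⟨Ψ', hΨ', f', g', hh'⟩ a b ha hb hab
    refine ⟨a • Ψ + b • Ψ', fun x σ => ?_, a • f + b • f', a • g + b • g', fun z => ?_⟩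
    · have := integral_combo_slice Ψ Ψ' a b x σ
      simp only [ContinuousMap.add_apply, ContinuousMap.smul_apply, smul_eq_mul]
      rw [this]
      exact coe_combo_le ha hb hab (hΨ x σ) (hΨ' x σ)
    · simp only [ContinuousMap.add_apply, ContinuousMap.smul_apply, smul_eq_mul, hh z, hh' z]
      rw [integral_add ((integrable_continuousMap μ f).const_mul a)
        ((integrable_continuousMap μ f').const_mul b), integral_const_mul, integral_const_mul,
        integral_add ((integrable_continuousMap ν g).const_mul a)
        ((integrable_continuousMap ν g').const_mul b), integral_const_mul, integral_const_mul]
      linear_combination -r * hab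
  have halt : ∀ h ∈ 𝒞, ∃ z, h z ≤ 0 := by
    rintro h ⟨Ψ, hΨ, f, g, hh⟩
    by_contra! hpos
    have : Nonempty X := μ.nonempty
    have : Nonempty Y := ν.nonempty
    obtain ⟨z₀, -, hz₀⟩ := isCompact_univ.exists_isMinOn Set.univ_nonempty h.continuous.continuousOn
    set I := ∫ x, f x ∂(μ : Measure X) + ∫ y, g y ∂(ν : Measure Y) with hI
    have hle : ∀ x y, I + r + h z₀ - f x - g y ≤ Ψ (x, y) := fun x y => by
      have h1 : h z₀ ≤ h (x, y) := hz₀ (Set.mem_univ _)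
      rw [hh (x, y)] at h1
      linarith
    have hmem : (ContinuousMap.const X (I + r + h z₀) - f, -g) ∈ dualPairs c := fun x σ => by
      refine le_trans (EReal.coe_le_coe_iff.2 ?_) (hΨ x σ)
      rw [← integral_directSum_slice]
      refine integral_mono (integrable_slice _ x σ) (integrable_slice _ x σ) fun y => ?_
      have := hle x y
      simp only [directSum, ContinuousMap.add_apply, ContinuousMap.comp_apply,
        ContinuousMap.fst_apply, ContinuousMap.snd_apply, ContinuousMap.sub_apply,
        ContinuousMap.const_apply, ContinuousMap.neg_apply]
      linarith
    have := hr _ hmem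
    simp only [ContinuousMap.sub_apply, ContinuousMap.const_apply, ContinuousMap.neg_apply] at this
    rw [integral_sub (integrable_const _) (integrable_continuousMap μ f), integral_neg] at this
    simp only [integral_const, probReal_univ, one_smul] at this
    linarith [hpos z₀]
  obtain ⟨π, hπ⟩ := exists_prob_integral_nonpos hne hconv halt
  have hval : ∀ Ψ ∈ subcosts c, ∀ (f : C(X, ℝ)) (g : C(Y, ℝ)),
      ∫ z, Ψ z ∂(π : Measure (X × Y)) + (∫ x, f x ∂(π : Measure (X × Y)).fst +
        ∫ y, g y ∂(π : Measure (X × Y)).snd) ≤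
      ∫ x, f x ∂(μ : Measure X) + ∫ y, g y ∂(ν : Measure Y) + r := fun Ψ hΨ f g => by
    have h1 := hπ _ (mem𝒞 Ψ hΨ f g)
    have hf : Integrable (fun z : X × Y => f z.1) (π : Measure (X × Y)) :=
      integrable_continuousMap π (f.comp ContinuousMap.fst)
    have hg : Integrable (fun z : X × Y => g z.2) (π : Measure (X × Y)) :=
      integrable_continuousMap π (g.comp ContinuousMap.snd)
    rw [Measure.fst, Measure.snd, integral_map measurable_fst.aemeasurable
      f.continuous.aestronglyMeasurable, integral_map measurable_snd.aemeasurable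
      g.continuous.aestronglyMeasurable]
    have h3 : ∫ z, (Ψ z + (f z.1 + g z.2)) ∂(π : Measure (X × Y)) =
        ∫ z, Ψ z ∂(π : Measure (X × Y)) + (∫ z, f z.1 ∂(π : Measure (X × Y)) +
          ∫ z, g z.2 ∂(π : Measure (X × Y))) := by
      rw [← integral_add hf hg]
      exact integral_add (integrable_continuousMap π Ψ) (hf.add hg)
    rw [← h3]
    have h2 : ∫ z, (Ψ z + (f z.1 + g z.2)) ∂(π : Measure (X × Y)) - (∫ x, f x ∂(μ : Measure X) +
        ∫ y, g y ∂(ν : Measure Y) + r) ≤ 0 := by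
      refine le_of_eq_of_le ?_ h1
      simp only [ContinuousMap.sub_apply, ContinuousMap.const_apply]
      rw [integral_sub (integrable_continuousMap π _) (integrable_const _)]
      simp [directSum]
    exact sub_nonpos.1 h2
  -- A linear functional bounded above vanishes.
  have hzero : ∀ d C : ℝ, (∀ k : ℝ, k * d ≤ C) → d = 0 := fun d C h => by
    by_contra hd
    have := h ((C + 1) / d)
    rw [div_mul_cancel₀ _ hd] at this
    linarith
  have hfst : (π : Measure (X × Y)).fst = μ := by
    refine ext_of_forall_integral_eq_of_IsFiniteMeasure fun f => sub_eq_zero.1 ?_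
    refine hzero _ (r - ∫ z, Ψ₀ z ∂(π : Measure (X × Y))) fun k => ?_
    have := hval Ψ₀ hΨ₀ (k • f.toContinuousMap) 0
    simp only [ContinuousMap.smul_apply, smul_eq_mul, ContinuousMap.zero_apply, integral_zero,
      integral_const_mul, BoundedContinuousFunction.coe_toContinuousMap] at this
    linarith
  have hsnd : (π : Measure (X × Y)).snd = ν := by
    refine ext_of_forall_integral_eq_of_IsFiniteMeasure fun g => sub_eq_zero.1 ?_
    refine hzero _ (r - ∫ z, Ψ₀ z ∂(π : Measure (X × Y))) fun k => ?_
    have := hval Ψ₀ hΨ₀ 0 (k • g.toContinuousMap)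
    simp only [ContinuousMap.smul_apply, smul_eq_mul, ContinuousMap.zero_apply, integral_zero,
      integral_const_mul, BoundedContinuousFunction.coe_toContinuousMap] at this
    linarith
  refine ⟨π, ⟨hfst, hsnd⟩, fun Ψ hΨ => ?_⟩
  simpa using hval Ψ hΨ 0 0

/-- `Θ` is an `L¹(π)`-limit of subcosts. -/
def IsSubcostLimit (c : X → ProbabilityMeasure Y → EReal) (π : ProbabilityMeasure (X × Y))
    (Θ : X × Y → ℝ) : Prop :=
  Integrable Θ (π : Measure (X × Y)) ∧
    ∀ ε > 0, ∃ Ψ ∈ subcosts c, ∫ z, |Θ z - Ψ z| ∂(π : Measure (X × Y)) ≤ ε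

lemma IsSubcostLimit.integral_le {Θ : X × Y → ℝ} (hΘ : IsSubcostLimit c π Θ) {r : ℝ}
    (hr : ∀ Ψ ∈ subcosts c, ∫ z, Ψ z ∂(π : Measure (X × Y)) ≤ r) :
    ∫ z, Θ z ∂(π : Measure (X × Y)) ≤ r := by
  have hB : BorelSpace (X × Y) := borelSpace_prod
  refine le_of_forall_pos_le_add fun ε hε => ?_
  obtain ⟨Ψ, hΨ, h⟩ := hΘ.2 ε hε
  have hint := integrable_continuousMap π Ψ
  calc ∫ z, Θ z ∂(π : Measure (X × Y))
      ≤ ∫ z, (Ψ z + |Θ z - Ψ z|) ∂(π : Measure (X × Y)) := by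
        refine integral_mono hΘ.1 (hint.add (hΘ.1.sub hint).abs) fun z => ?_
        simp only
        linarith [le_abs_self (Θ z - Ψ z)]
    _ = ∫ z, Ψ z ∂(π : Measure (X × Y)) + ∫ z, |Θ z - Ψ z| ∂(π : Measure (X × Y)) :=
        integral_add hint (hΘ.1.sub hint).abs
    _ ≤ r + ε := add_le_add (hr Ψ hΨ) h

/-- The indicator of `B` is approximated in `L¹(μ)` by continuous weights with values in `[0, 1]`,
so that mixing extends to measurable weights. -/
lemma IsSubcostLimit.ite {Θ₁ Θ₂ : X × Y → ℝ} (h₁ : IsSubcostLimit c π Θ₁)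
    (h₂ : IsSubcostLimit c π Θ₂) {B : Set X} (hB : MeasurableSet B) [DecidablePred (· ∈ B)] :
    IsSubcostLimit c π fun z => if z.1 ∈ B then Θ₁ z else Θ₂ z := by
  have hBorel : BorelSpace (X × Y) := borelSpace_prod
  have hint : Integrable (fun z : X × Y => if z.1 ∈ B then Θ₁ z else Θ₂ z)
      (π : Measure (X × Y)) :=
    Integrable.piecewise (s := {z : X × Y | z.1 ∈ B}) (measurable_fst hB)
      h₁.1.integrableOn h₂.1.integrableOn
  refine ⟨hint, fun ε hε => ?_⟩
  obtain ⟨Ψ₁, hΨ₁, hd₁⟩ := h₁.2 (ε / 4) (by positivity)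
  obtain ⟨Ψ₂, hΨ₂, hd₂⟩ := h₂.2 (ε / 4) (by positivity)
  set C : ℝ := ‖Ψ₁ - Ψ₂‖ + 1 with hC
  have hC0 : 0 < C := by positivity
  have hind : Integrable (B.indicator fun _ => (1 : ℝ)) (π : Measure (X × Y)).fst :=
    (integrable_const 1).indicator hB
  obtain ⟨v, hv, hvint⟩ := hind.exists_boundedContinuous_integral_sub_le
    (ε := ε / (2 * C)) (by positivity)
  let w : C(X, ℝ) := ⟨fun x => max 0 (min 1 (v x)), by fun_prop⟩
  have hw0 : ∀ x, 0 ≤ w x := fun x => le_max_left _ _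
  have hw1 : ∀ x, w x ≤ 1 := fun x => max_le zero_le_one (min_le_left _ _)
  have hwv : ∀ x, |B.indicator (fun _ => (1 : ℝ)) x - w x| ≤
      ‖B.indicator (fun _ => (1 : ℝ)) x - v x‖ := fun x => by
    have hclamp : B.indicator (fun _ => (1 : ℝ)) x =
        max 0 (min 1 (B.indicator (fun _ => (1 : ℝ)) x)) := by
      by_cases hx : x ∈ B <;> simp [hx]
    rw [Real.norm_eq_abs]
    conv_lhs => rw [hclamp]
    exact (abs_max_sub_max_le_max _ _ _ _).trans (max_le (by simp)
      ((abs_min_sub_min_le_max _ _ _ _).trans (max_le (by simp) le_rfl)))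
  have hwint : Integrable (fun z : X × Y => |B.indicator (fun _ => (1 : ℝ)) z.1 - w z.1|)
      (π : Measure (X × Y)) := by
    have : Integrable (fun x => |B.indicator (fun _ => (1 : ℝ)) x - w x|)
        (π : Measure (X × Y)).fst :=
      (hind.sub (integrable_continuousMap
        (⟨(π : Measure (X × Y)).fst, inferInstance⟩ : ProbabilityMeasure X) w)).abs
    exact this.comp_measurable measurable_fst
  have hwle : ∫ z, |B.indicator (fun _ => (1 : ℝ)) z.1 - w z.1| ∂(π : Measure (X × Y)) ≤
      ε / (2 * C) := by
    refine le_trans (integral_mono hwint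
      ((hind.sub hvint).norm.comp_measurable measurable_fst) fun z => hwv z.1) ?_
    rw [Measure.fst, integral_map measurable_fst.aemeasurable] at hv
    · exact hv
    · exact (hind.sub hvint).norm.aestronglyMeasurable
  refine ⟨_, weighted_mem_subcosts hΨ₁ hΨ₂ hw0 hw1, ?_⟩
  have hi₁ : Integrable (fun z => |Θ₁ z - Ψ₁ z|) (π : Measure (X × Y)) :=
    (h₁.1.sub (integrable_continuousMap π Ψ₁)).abs
  have hi₂ : Integrable (fun z => |Θ₂ z - Ψ₂ z|) (π : Measure (X × Y)) :=
    (h₂.1.sub (integrable_continuousMap π Ψ₂)).abs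
  calc _ ≤ ∫ z, (|Θ₁ z - Ψ₁ z| + |Θ₂ z - Ψ₂ z| +
        C * |B.indicator (fun _ => (1 : ℝ)) z.1 - w z.1|) ∂(π : Measure (X × Y)) := by
        refine integral_mono (hint.sub (integrable_continuousMap π _)).abs
          ((hi₁.add hi₂).add (hwint.const_mul C)) fun z => ?_
        have hΨ : |Ψ₁ z - Ψ₂ z| ≤ C := by
          have := (Ψ₁ - Ψ₂).norm_coe_le_norm z
          rw [Real.norm_eq_abs, ContinuousMap.sub_apply] at this
          linarith
        simp only [ContinuousMap.add_apply, ContinuousMap.mul_apply, ContinuousMap.comp_apply,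
          ContinuousMap.sub_apply, ContinuousMap.one_apply, ContinuousMap.fst_apply]
        by_cases hz : z.1 ∈ B
        · have e : Θ₁ z - (w z.1 * Ψ₁ z + (1 - w z.1) * Ψ₂ z) =
            (Θ₁ z - Ψ₁ z) + (1 - w z.1) * (Ψ₁ z - Ψ₂ z) := by ring
          rw [if_pos hz, e, Set.indicator_of_mem hz]
          have h3 := abs_add_le (Θ₁ z - Ψ₁ z) ((1 - w z.1) * (Ψ₁ z - Ψ₂ z))
          rw [abs_mul] at h3
          have h4 := mul_le_mul_of_nonneg_left hΨ (abs_nonneg (1 - w z.1))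
          linarith [abs_nonneg (Θ₂ z - Ψ₂ z)]
        · have e : Θ₂ z - (w z.1 * Ψ₁ z + (1 - w z.1) * Ψ₂ z) =
            (Θ₂ z - Ψ₂ z) + (0 - w z.1) * (Ψ₁ z - Ψ₂ z) := by ring
          rw [if_neg hz, e, Set.indicator_of_notMem hz]
          have h3 := abs_add_le (Θ₂ z - Ψ₂ z) ((0 - w z.1) * (Ψ₁ z - Ψ₂ z))
          rw [abs_mul] at h3
          have h4 := mul_le_mul_of_nonneg_left hΨ (abs_nonneg (0 - w z.1))
          linarith [abs_nonneg (Θ₁ z - Ψ₁ z)]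
    _ = ∫ z, |Θ₁ z - Ψ₁ z| ∂(π : Measure (X × Y)) + ∫ z, |Θ₂ z - Ψ₂ z| ∂(π : Measure (X × Y)) +
        C * ∫ z, |B.indicator (fun _ => (1 : ℝ)) z.1 - w z.1| ∂(π : Measure (X × Y)) := by
        rw [← integral_const_mul, ← integral_add hi₁ hi₂]
        exact integral_add (hi₁.add hi₂) (hwint.const_mul C)
    _ ≤ ε / 4 + ε / 4 + C * (ε / (2 * C)) := by gcongr
    _ = ε := by field_simp; ring

/-- For a plan as in `exists_plan_integral_le`, the cost is at most `r`: the partial maxima of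
countably many dual pairs along the disintegration come from `L¹`-limits of subcosts. -/
theorem erealIntegral_disintegration_le (hc : LowerSemicontinuous (Function.uncurry c))
    (hbot : ∀ x σ, c x σ ≠ ⊥) (hconv : ∀ x, ConvexOnProb (c x))
    {κ : Kernel X Y} [IsMarkovKernel κ] (hκ : IsDisintegration κ μ π) {r : ℝ}
    (hr : ∀ Ψ ∈ subcosts c, ∫ z, Ψ z ∂(π : Measure (X × Y)) ≤ r) :
    erealIntegral (μ : Measure X) (fun x => c x ⟨κ x, inferInstance⟩) ≤ r := by
  classical
  have hBorel : BorelSpace (X × Y) := borelSpace_prod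
  obtain ⟨p, hp, hsup⟩ := exists_seq_dualPairs hc hbot hconv
  let v : ℕ → X → ℝ := fun n x => (p n).1 x + ∫ y, (p n).2 y ∂κ x
  let u : ℕ → X → ℝ := partialSups v
  have hvint : ∀ n, Integrable (v n) (μ : Measure X) := fun n =>
    (integrable_continuousMap μ (p n).1).add (integrable_integral_kernel μ κ (p n).2)
  have hvmeas : ∀ n, Measurable (v n) := fun n =>
    (p n).1.continuous.measurable.add
      ((p n).2.continuous.stronglyMeasurable.integral_kernel).measurable
  have husucc : ∀ n x, u (n + 1) x = max (u n x) (v (n + 1) x) := fun n x => by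
    simp only [u, partialSups_add_one]
    rfl
  have humeas : ∀ n, Measurable (u n) := fun n => by
    induction n with
    | zero => simpa [u] using hvmeas 0
    | succ n ih =>
      have : u (n + 1) = fun x => max (u n x) (v (n + 1) x) := funext (husucc n)
      rw [this]
      exact ih.max (hvmeas (n + 1))
  have huint : ∀ n, Integrable (u n) (μ : Measure X) := fun n => by
    induction n with
    | zero => simpa [u] using hvint 0
    | succ n ih =>
      have : u (n + 1) = u n ⊔ v (n + 1) := funext (husucc n)
      rw [this]
      exact ih.sup (hvint (n + 1))
  have hΘ : ∀ n, ∃ Θ : X × Y → ℝ, IsSubcostLimit c π Θ ∧ ∀ x, ∫ y, Θ (x, y) ∂κ x = u n x := by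
    have hbase : ∀ n, IsSubcostLimit c π (directSum (p n).1 (p n).2) := fun n =>
      ⟨integrable_continuousMap π _, fun ε hε =>
        ⟨_, directSum_mem_subcosts (hp n), by simpa using hε.le⟩⟩
    have hslice : ∀ n x, ∫ y, directSum (p n).1 (p n).2 (x, y) ∂κ x = v n x := fun n x =>
      integral_directSum_slice (p n).1 (p n).2 x ⟨κ x, inferInstance⟩
    intro n
    induction n with
    | zero => exact ⟨_, hbase 0, fun x => by simpa [u] using hslice 0 x⟩
    | succ n ih =>
      obtain ⟨Θ, hΘ, hΘu⟩ := ih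
      have hB : MeasurableSet {x | v (n + 1) x ≤ u n x} :=
        measurableSet_le (hvmeas _) (humeas n)
      refine ⟨_, hΘ.ite (hbase (n + 1)) hB, fun x => ?_⟩
      rw [husucc]
      by_cases hx : v (n + 1) x ≤ u n x
      · simp [hx, hΘu x]
      · simp [hx, hslice, (not_le.1 hx).le]
  refine erealIntegral_le_of_monotone huint (fun x i j hij => (partialSups v).monotone hij x)
    (fun x => ?_) fun n => ?_
  · have hx := hsup x ⟨κ x, inferInstance⟩
    rw [hx]
    refine le_antisymm (iSup_le fun n => ?_) (iSup_le fun n => ?_)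
    · refine le_trans (EReal.coe_le_coe_iff.2 ?_) (le_iSup (fun n => (u n x : EReal)) n)
      exact le_partialSups v n x
    · rw [← hx]
      induction n with
      | zero => exact hp 0 x ⟨κ x, inferInstance⟩
      | succ n ih =>
        rw [husucc]
        rcases max_cases (u n x) (v (n + 1) x) with h | h <;> rw [h.1]
        · exact ih
        · exact hp (n + 1) x ⟨κ x, inferInstance⟩
  · obtain ⟨Θ, hΘ, hΘu⟩ := hΘ n
    refine le_trans (le_of_eq ?_) (hΘ.integral_le hr)
    have hint := hΘ.1
    rw [IsDisintegration] at hκ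
    rw [hκ] at hint ⊢
    rw [Measure.integral_compProd hint]
    exact integral_congr_ae (ae_of_all _ fun x => (hΘu x).symm)

end Plans

/-! ### Weak transport and backward linear transfers -/

section Duality

variable {X Y : Type*} [TopologicalSpace X] [CompactSpace X] [TopologicalSpace.MetrizableSpace X]
  [MeasurableSpace X] [BorelSpace X] [TopologicalSpace Y] [CompactSpace Y]
  [TopologicalSpace.MetrizableSpace Y] [MeasurableSpace Y] [BorelSpace Y]
  {c : X → ProbabilityMeasure Y → EReal} {μ : ProbabilityMeasure X} {ν : ProbabilityMeasure Y}

/-- Duality for weak transport; there is no duality gap and no restriction on the marginals. -/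
theorem weakTransport_eq_iSup (hc : LowerSemicontinuous (Function.uncurry c))
    (hbot : ∀ x σ, c x σ ≠ ⊥) (hconv : ∀ x, ConvexOnProb (c x)) (μ : ProbabilityMeasure X)
    (ν : ProbabilityMeasure Y) :
    weakTransport c μ ν = ⨆ p : dualPairs c,
      ((∫ x, p.1.1 x ∂(μ : Measure X) + ∫ y, p.1.2 y ∂(ν : Measure Y) : ℝ) : EReal) := by
  refine le_antisymm ?_ (iSup_le fun p => le_sInf ?_)
  · set D := ⨆ p : dualPairs c,
      ((∫ x, p.1.1 x ∂(μ : Measure X) + ∫ y, p.1.2 y ∂(ν : Measure Y) : ℝ) : EReal) with hD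
    have hle : ∀ p ∈ dualPairs c,
        ((∫ x, p.1 x ∂(μ : Measure X) + ∫ y, p.2 y ∂(ν : Measure Y) : ℝ) : EReal) ≤ D :=
      fun p hp => le_iSup (fun p : dualPairs c =>
        ((∫ x, p.1.1 x ∂(μ : Measure X) + ∫ y, p.1.2 y ∂(ν : Measure Y) : ℝ) : EReal)) ⟨p, hp⟩
    by_cases htop : D = ⊤
    · simp [htop]
    obtain ⟨p₀, hp₀⟩ := dualPairs_nonempty hc hbot
    have hDbot : D ≠ ⊥ := fun h => by
      have := hle p₀ hp₀
      rw [h, le_bot_iff] at this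
      exact EReal.coe_ne_bot _ this
    obtain ⟨r, hr⟩ : ∃ r : ℝ, D = r := ⟨D.toReal, (EReal.coe_toReal htop hDbot).symm⟩
    rw [hr] at hle ⊢
    obtain ⟨π, hπ, hπr⟩ := exists_plan_integral_le hc hbot fun p hp =>
      EReal.coe_le_coe_iff.1 (hle p hp)
    let _ := TopologicalSpace.metrizableSpaceMetric Y
    have : Nonempty Y := ν.nonempty
    have hdis : IsDisintegration (π : Measure (X × Y)).condKernel μ π := by
      rw [IsDisintegration, ← hπ.1, Measure.disintegrate]
    have hmem : erealIntegral (μ : Measure X) (fun x =>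
        c x ⟨(π : Measure (X × Y)).condKernel x, inferInstance⟩) ∈ weakTransportValues c μ ν :=
      ⟨π, hπ, _, inferInstance, hdis, rfl⟩
    exact (sInf_le hmem).trans (erealIntegral_disintegration_le hc hbot hconv hdis hπr)
  · rintro _ ⟨π, hπ, κ, hκ, hdis, rfl⟩
    rw [integral_snd_marginal hπ hdis, ← integral_add (integrable_continuousMap μ p.1.1)
      (integrable_integral_kernel μ κ p.1.2)]
    exact coe_integral_le_erealIntegral ((integrable_continuousMap μ p.1.1).add
      (integrable_integral_kernel μ κ p.1.2)) fun x => p.2 x ⟨κ x, inferInstance⟩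

lemma lowerSemicontinuous_weakTransport (hc : LowerSemicontinuous (Function.uncurry c))
    (hbot : ∀ x σ, c x σ ≠ ⊥) (hconv : ∀ x, ConvexOnProb (c x)) :
    LowerSemicontinuous (Function.uncurry (weakTransport c)) := by
  have : Function.uncurry (weakTransport c) = fun q => ⨆ p : dualPairs c,
      ((∫ x, p.1.1 x ∂(q.1 : Measure X) + ∫ y, p.1.2 y ∂(q.2 : Measure Y) : ℝ) : EReal) :=
    funext fun q => weakTransport_eq_iSup hc hbot hconv q.1 q.2
  rw [this]
  refine lowerSemicontinuous_iSup fun p => (continuous_coe_real_ereal.comp ?_).lowerSemicontinuous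
  exact ((continuous_integral p.1.1).comp continuous_fst).add
    ((continuous_integral p.1.2).comp continuous_snd)

lemma jointlyConvex_weakTransport (hc : LowerSemicontinuous (Function.uncurry c))
    (hbot : ∀ x σ, c x σ ≠ ⊥) (hconv : ∀ x, ConvexOnProb (c x)) :
    JointlyConvex (weakTransport c) := by
  intro t μ₀ μ₁ ν₀ ν₁
  simp_rw [weakTransport_eq_iSup hc hbot hconv]
  refine iSup_le fun p => ?_
  have h : ∫ x, p.1.1 x ∂(mix t μ₀ μ₁ : Measure X) + ∫ y, p.1.2 y ∂(mix t ν₀ ν₁ : Measure Y) =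
      (1 - t) * (∫ x, p.1.1 x ∂(μ₀ : Measure X) + ∫ y, p.1.2 y ∂(ν₀ : Measure Y)) +
      t * (∫ x, p.1.1 x ∂(μ₁ : Measure X) + ∫ y, p.1.2 y ∂(ν₁ : Measure Y)) := by
    rw [integral_mix, integral_mix]
    ring
  have h0 : (0 : EReal) ≤ ((1 - (t : ℝ) : ℝ) : EReal) := by exact_mod_cast sub_nonneg.2 t.2.2
  have h1 : (0 : EReal) ≤ ((t : ℝ) : EReal) := by exact_mod_cast t.2.1
  rw [h, EReal.coe_add, EReal.coe_mul, EReal.coe_mul]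
  exact add_le_add (mul_le_mul_of_nonneg_left (le_iSup (fun p : dualPairs c =>
      ((∫ x, p.1.1 x ∂(μ₀ : Measure X) + ∫ y, p.1.2 y ∂(ν₀ : Measure Y) : ℝ) : EReal)) p) h0)
    (mul_le_mul_of_nonneg_left (le_iSup (fun p : dualPairs c =>
      ((∫ x, p.1.1 x ∂(μ₁ : Measure X) + ∫ y, p.1.2 y ∂(ν₁ : Measure Y) : ℝ) : EReal)) p) h1)

lemma coe_sub_le_coe_iff {u s : ℝ} {a : EReal} :
    (u : EReal) - a ≤ s ↔ ((u - s : ℝ) : EReal) ≤ a := by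
  induction a with
  | bot =>
    rw [EReal.coe_sub_bot]
    simp [-EReal.coe_sub]
  | top => simp
  | coe a =>
    rw [← EReal.coe_sub, EReal.coe_le_coe_iff, EReal.coe_le_coe_iff]
    constructor <;> intro h <;> linarith

lemma legendre_le_coe_iff {F : ProbabilityMeasure Y → EReal} {g : C(Y, ℝ)} {s : ℝ} :
    legendre F g ≤ s ↔
      ∀ σ : ProbabilityMeasure Y, ((∫ y, g y ∂(σ : Measure Y) - s : ℝ) : EReal) ≤ F σ := by
  simp only [legendre, iSup_le_iff, coe_sub_le_coe_iff]

lemma mem_dualPairs_iff {f : C(X, ℝ)} {g : C(Y, ℝ)} :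
    (f, g) ∈ dualPairs c ↔ ∀ x, legendre (c x) g ≤ ((-f x : ℝ) : EReal) := by
  simp only [legendre_le_coe_iff, sub_neg_eq_add]
  refine forall_congr' fun x => forall_congr' fun σ => ?_
  simp only [add_comm]

lemma diracProba_coe (x : X) : (diracProba x : Measure X) = Measure.dirac x := rfl

lemma IsBackwardKantorovichOperator.eq_legendre
    {T : ProbabilityMeasure X → ProbabilityMeasure Y → EReal} {S : C(Y, ℝ) → X → ℝ}
    (hS : IsBackwardKantorovichOperator T S) {x : X} (hx : diracProba x ∈ firstDomain T)
    (g : C(Y, ℝ)) : ((S g x : ℝ) : EReal) = legendre (T (diracProba x)) g := by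
  rw [(hS.2 _ hx g).2, diracProba_coe, integral_dirac]

/-- The operator attached to a cost: the Legendre transform in the second variable. It takes the
value `0` where that transform is infinite, which does not occur under the hypotheses below. -/
noncomputable def costOperator (c : X → ProbabilityMeasure Y → EReal) (g : C(Y, ℝ)) (x : X) : ℝ :=
  (legendre (c x) g).toReal

lemma legendre_le_of_le {F : ProbabilityMeasure Y → EReal} {m : ℝ} (hm : ∀ σ, (m : EReal) ≤ F σ)
    (g : C(Y, ℝ)) : legendre F g ≤ ((‖g‖ - m : ℝ) : EReal) := by
  refine legendre_le_coe_iff.2 fun σ => le_trans (EReal.coe_le_coe_iff.2 ?_) (hm σ)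
  linarith [(abs_le.1 (abs_integral_le_norm σ g)).2]

lemma coe_costOperator (hc : LowerSemicontinuous (Function.uncurry c))
    (hbot : ∀ x σ, c x σ ≠ ⊥) (hfin : ∀ x, ∃ σ, c x σ ≠ ⊤) (g : C(Y, ℝ)) (x : X) :
    (costOperator c g x : EReal) = legendre (c x) g := by
  obtain ⟨m, hm⟩ := exists_real_le hc fun p => hbot p.1 p.2
  refine EReal.coe_toReal ?_ ?_
  · exact ((legendre_le_of_le (fun σ => hm (x, σ)) g).trans_lt (EReal.coe_lt_top _)).ne
  · obtain ⟨σ, hσ⟩ := hfin x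
    refine (lt_of_lt_of_le ?_ (le_iSup (fun σ : ProbabilityMeasure Y =>
      ((∫ y, g y ∂(σ : Measure Y) : ℝ) : EReal) - c x σ) σ)).ne'
    rw [← EReal.coe_toReal hσ (hbot x σ), ← EReal.coe_sub]
    exact EReal.bot_lt_coe _

lemma upperSemicontinuous_costOperator (hc : LowerSemicontinuous (Function.uncurry c))
    (hbot : ∀ x σ, c x σ ≠ ⊥) (hfin : ∀ x, ∃ σ, c x σ ≠ ⊤) (g : C(Y, ℝ)) :
    UpperSemicontinuous (costOperator c g) := by
  intro x₀ b hb
  obtain ⟨b₁, hb₁, hb₂⟩ := exists_between hb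
  obtain ⟨f, hf, hfg⟩ := exists_mem_dualPairs (a := -b₁) (x₀ := x₀) (g := g) hc hbot fun σ => by
    have h := legendre_le_coe_iff.1 (coe_costOperator hc hbot hfin g x₀).ge σ
    exact lt_of_lt_of_le (EReal.coe_lt_coe_iff.2 (by linarith)) h
  filter_upwards [(f.continuous.neg.tendsto x₀).eventually_lt_const
    (by simpa [hf] using hb₂)] with x hx
  have h := mem_dualPairs_iff.1 hfg x
  rw [← coe_costOperator hc hbot hfin, EReal.coe_le_coe_iff] at h
  exact h.trans_lt hx

/-- If the transport cost of some plan with first marginal `μ` is finite, then the associated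
operator takes values in `L¹(μ)`. -/
lemma integrable_costOperator (hc : LowerSemicontinuous (Function.uncurry c))
    (hbot : ∀ x σ, c x σ ≠ ⊥) (hfin : ∀ x, ∃ σ, c x σ ≠ ⊤)
    (hμ : ∃ ν, weakTransport c μ ν ≠ ⊤) (g : C(Y, ℝ)) :
    Integrable (costOperator c g) (μ : Measure X) := by
  obtain ⟨m, hm⟩ := exists_real_le hc fun p => hbot p.1 p.2
  obtain ⟨ν, hν⟩ := hμ
  obtain ⟨r, ⟨π, -, κ, hκ, -, rfl⟩, hr⟩ : ∃ r ∈ weakTransportValues c μ ν, r ≠ ⊤ := by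
    by_contra! h
    exact hν (sInf_eq_top.2 h)
  set k : X → EReal := fun x => c x ⟨κ x, inferInstance⟩ with hk
  have hpos : ∫⁻ x, (k x).toENNReal ∂(μ : Measure X) ≠ ⊤ := by
    intro htop
    have hneg : ∫⁻ x, (-k x).toENNReal ∂(μ : Measure X) ≠ ⊤ := by
      refine ((lintegral_mono (g := fun _ => ENNReal.ofReal (-m)) fun x => ?_).trans_lt ?_).ne
      · rw [← toENNReal_coe_real, EReal.coe_neg]
        exact EReal.toENNReal_le_toENNReal (EReal.neg_le_neg_iff.2 (hm (x, ⟨κ x, inferInstance⟩)))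
      · simp
    apply hr
    rw [erealIntegral, htop, EReal.coe_ennreal_top]
    lift ∫⁻ x, (-k x).toENNReal ∂(μ : Measure X) to NNReal using hneg with q
    exact EReal.top_sub_coe q
  refine ⟨(upperSemicontinuous_costOperator hc hbot hfin g).measurable.aestronglyMeasurable, ?_⟩
  refine (lintegral_mono (g := fun x => ENNReal.ofReal (‖g‖ + |m|) + (k x).toENNReal)
    fun x => ?_).trans_lt ?_
  · have hup : legendre (c x) g ≤ _ := legendre_le_of_le (fun σ => hm (x, σ)) g
    have hlow := legendre_le_coe_iff.1 (coe_costOperator hc hbot hfin g x).ge ⟨κ x, inferInstance⟩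
    rw [← coe_costOperator hc hbot hfin, EReal.coe_le_coe_iff] at hup
    have hg := abs_integral_le_norm (⟨κ x, inferInstance⟩ : ProbabilityMeasure Y) g
    by_cases htop : k x = ⊤
    · simp [htop]
    · have hkx : k x = ((k x).toReal : EReal) := (EReal.coe_toReal htop (hbot _ _)).symm
      change _ ≤ k x at hlow
      rw [hkx, EReal.coe_le_coe_iff] at hlow
      simp only
      rw [EReal.toENNReal_of_ne_top htop, ← ofReal_norm, Real.norm_eq_abs]
      refine le_trans (ENNReal.ofReal_le_ofReal (q := ‖g‖ + |m| + max (k x).toReal 0) ?_) ?_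
      · have h1 := (abs_le.1 hg).1
        have h2 := le_max_left (k x).toReal 0
        have h3 := le_max_right (k x).toReal 0
        have h4 := neg_abs_le m
        have h5 := abs_nonneg m
        rw [abs_le]
        constructor <;> linarith
      · rw [ENNReal.ofReal_add (by positivity) (le_max_right _ _)]
        simp
  · rw [lintegral_add_left measurable_const]
    refine ENNReal.add_lt_top.2 ⟨?_, hpos.lt_top⟩
    simp

/-- The supremum in the Legendre transform of `weakTransport c μ` is attained, and computed by the
alternative `exists_prob_integral_nonpos` on `Y`. -/
theorem legendre_weakTransport (hc : LowerSemicontinuous (Function.uncurry c))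
    (hbot : ∀ x σ, c x σ ≠ ⊥) (hconv : ∀ x, ConvexOnProb (c x)) (hfin : ∀ x, ∃ σ, c x σ ≠ ⊤)
    (hμ : ∃ ν, weakTransport c μ ν ≠ ⊤) (g : C(Y, ℝ)) :
    legendre (weakTransport c μ) g = ((∫ x, costOperator c g x ∂(μ : Measure X) : ℝ) : EReal) := by
  have hint := integrable_costOperator hc hbot hfin hμ g
  refine le_antisymm (legendre_le_coe_iff.2 fun ν => le_sInf ?_) ?_
  · rintro _ ⟨π, hπ, κ, hκ, hdis, rfl⟩
    rw [integral_snd_marginal hπ hdis, ← integral_sub (integrable_integral_kernel μ κ g) hint]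
    exact coe_integral_le_erealIntegral ((integrable_integral_kernel μ κ g).sub hint) fun x =>
      legendre_le_coe_iff.1 (coe_costOperator hc hbot hfin g x).ge ⟨κ x, inferInstance⟩
  set I := ∫ x, costOperator c g x ∂(μ : Measure X) with hI
  let 𝒞 : Set C(Y, ℝ) := {h | ∃ p ∈ dualPairs c, ∀ y,
    h y = ∫ x, p.1 x ∂(μ : Measure X) + p.2 y - g y + I}
  have mem𝒞 : ∀ p ∈ dualPairs c,
      p.2 - g + ContinuousMap.const Y (∫ x, p.1 x ∂(μ : Measure X) + I) ∈ 𝒞 :=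
    fun p hp => ⟨p, hp, fun y => by simp; ring⟩
  have hne : 𝒞.Nonempty := by
    obtain ⟨p, hp⟩ := dualPairs_nonempty hc hbot
    exact ⟨_, mem𝒞 p hp⟩
  have hcv : Convex ℝ 𝒞 := by
    rintro h ⟨p, hp, hh⟩ h' ⟨p', hp', hh'⟩ a b ha hb hab
    refine ⟨a • p + b • p', convex_dualPairs hp hp' ha hb hab, fun y => ?_⟩
    simp only [Prod.fst_add, Prod.smul_fst, Prod.snd_add, Prod.smul_snd, ContinuousMap.add_apply,
      ContinuousMap.smul_apply, smul_eq_mul, hh y, hh' y]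
    rw [integral_add ((integrable_continuousMap μ p.1).const_mul a)
      ((integrable_continuousMap μ p'.1).const_mul b), integral_const_mul, integral_const_mul]
    linear_combination (I - g y) * hab
  have halt : ∀ h ∈ 𝒞, ∃ y, h y ≤ 0 := by
    rintro h ⟨p, hp, hh⟩
    by_contra! hpos
    have : Nonempty Y := hμ.choose.nonempty
    obtain ⟨y₀, -, hy₀⟩ := isCompact_univ.exists_isMinOn Set.univ_nonempty h.continuous.continuousOn
    -- Then `(p.1 + h y₀ - J - I, g)` is a dual pair, and its integral against `μ` would give
    -- `h y₀ ≤ 0`.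
    set J := ∫ x, p.1 x ∂(μ : Measure X) with hJ
    have hle : ∀ x, costOperator c g x ≤ J + I - h y₀ - p.1 x := fun x => by
      rw [← EReal.coe_le_coe_iff, coe_costOperator hc hbot hfin]
      refine legendre_le_coe_iff.2 fun σ => le_trans (EReal.coe_le_coe_iff.2 ?_) (hp x σ)
      have h1 : ∫ y, g y ∂(σ : Measure Y) ≤
          ∫ y, (p.2 y + (J + I - h y₀)) ∂(σ : Measure Y) := by
        refine integral_mono (integrable_continuousMap σ g)
          ((integrable_continuousMap σ p.2).add (integrable_const _)) fun y => ?_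
        have h2 : h y₀ ≤ h y := hy₀ (Set.mem_univ y)
        rw [hh y] at h2
        simp only
        linarith
      rw [integral_add (integrable_continuousMap σ p.2) (integrable_const _)] at h1
      simp only [integral_const, probReal_univ, one_smul] at h1
      linarith
    have := integral_mono hint ((integrable_const (J + I - h y₀)).sub
      (integrable_continuousMap μ p.1)) hle
    simp only [Pi.sub_apply] at this
    rw [integral_sub (integrable_const _) (integrable_continuousMap μ p.1)] at this
    simp only [integral_const, probReal_univ, one_smul] at this
    linarith [hpos y₀]
  obtain ⟨ν, hν⟩ := exists_prob_integral_nonpos hne hcv halt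
  have hT : weakTransport c μ ν ≤ ((∫ y, g y ∂(ν : Measure Y) - I : ℝ) : EReal) := by
    rw [weakTransport_eq_iSup hc hbot hconv]
    refine iSup_le fun p => EReal.coe_le_coe_iff.2 ?_
    have h := hν _ (mem𝒞 p.1 p.2)
    simp only [ContinuousMap.add_apply, ContinuousMap.sub_apply, ContinuousMap.const_apply] at h
    have hsub : Integrable (fun y => p.1.2 y - g y) (ν : Measure Y) :=
      (integrable_continuousMap ν p.1.2).sub (integrable_continuousMap ν g)
    rw [integral_add hsub (integrable_const _), integral_sub (integrable_continuousMap ν p.1.2)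
      (integrable_continuousMap ν g)] at h
    simp only [integral_const, probReal_univ, one_smul] at h
    linarith
  calc ((I : ℝ) : EReal)
      = ((∫ y, g y ∂(ν : Measure Y) : ℝ) : EReal) -
        ((∫ y, g y ∂(ν : Measure Y) - I : ℝ) : EReal) := by
        rw [← EReal.coe_sub, sub_sub_cancel]
    _ ≤ ((∫ y, g y ∂(ν : Measure Y) : ℝ) : EReal) - weakTransport c μ ν :=
        EReal.sub_le_sub le_rfl hT
    _ ≤ legendre (weakTransport c μ) g := le_iSup (fun ν : ProbabilityMeasure Y =>
        ((∫ y, g y ∂(ν : Measure Y) : ℝ) : EReal) - weakTransport c μ ν) ν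

/-- A finite transport cost from `δ_x` forces `c x` to be finite somewhere. -/
lemma exists_cost_ne_top {x : X} (h : ∃ ν, weakTransport c (diracProba x) ν ≠ ⊤) :
    ∃ σ, c x σ ≠ ⊤ := by
  obtain ⟨ν, hν⟩ := h
  by_contra! hx
  refine hν (sInf_eq_top.2 ?_)
  rintro _ ⟨π, -, κ, hκ, -, rfl⟩
  rw [erealIntegral, diracProba_coe, lintegral_dirac, lintegral_dirac, hx ⟨κ x, inferInstance⟩]
  simp

theorem isBackwardLinearTransfer_weakTransport [Nonempty X]
    (hc : LowerSemicontinuous (Function.uncurry c))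
    (hbot : ∀ x σ, c x σ ≠ ⊥) (hconv : ∀ x, ConvexOnProb (c x))
    (hT : ∀ μ ν, weakTransport c μ ν ≠ ⊥)
    (hdirac : ∀ x : X, diracProba x ∈ firstDomain (weakTransport c)) :
    IsBackwardLinearTransfer (weakTransport c) := by
  have hfin : ∀ x, ∃ σ, c x σ ≠ ⊤ := fun x =>
    exists_cost_ne_top ((hdirac x).imp fun _ h => h.2)
  refine ⟨hT, ?_, jointlyConvex_weakTransport hc hbot hconv,
    lowerSemicontinuous_weakTransport hc hbot hconv, costOperator c,
    upperSemicontinuous_costOperator hc hbot hfin, fun μ hμ g => ?_⟩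
  · obtain ⟨ν, hν⟩ := hdirac (Classical.arbitrary X)
    exact ⟨_, ν, hν.2⟩
  · have hμ' : ∃ ν, weakTransport c μ ν ≠ ⊤ := hμ.imp fun _ h => h.2
    exact ⟨integrable_costOperator hc hbot hfin hμ' g,
      legendre_weakTransport hc hbot hconv hfin hμ' g⟩

lemma mix_self {Ω : Type*} [MeasurableSpace Ω] (t : unitInterval) (μ : ProbabilityMeasure Ω) :
    mix t μ μ = μ := by
  apply ProbabilityMeasure.toMeasure_injective
  change ENNReal.ofReal (1 - (t : ℝ)) • (μ : Measure Ω) +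
    ENNReal.ofReal (t : ℝ) • (μ : Measure Ω) = _
  rw [← add_smul, ← ENNReal.ofReal_add (sub_nonneg.2 t.2.2) t.2.1]
  simp

/-- A backward linear transfer is the weak transport of its restriction to Dirac masses: its
continuous affine minorants restrict to dual pairs, and conversely each dual pair `(f, g)` satisfies
`f ≤ -S g`, so that it minorizes the transfer through `T_μ^* g = ∫ S g dμ`. -/
theorem IsBackwardLinearTransfer.eq_weakTransport
    {T : ProbabilityMeasure X → ProbabilityMeasure Y → EReal} (hT : IsBackwardLinearTransfer T)
    (hdirac : ∀ x : X, diracProba x ∈ firstDomain T)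
    (hc : LowerSemicontinuous (Function.uncurry fun x : X => T (diracProba x)))
    (hconv : ∀ x : X, ConvexOnProb (T (diracProba x)))
    (μ : ProbabilityMeasure X) (ν : ProbabilityMeasure Y) :
    T μ ν = weakTransport (fun x => T (diracProba x)) μ ν := by
  obtain ⟨hbot, -, hjc, hlsc, S, hS⟩ := hT
  rw [weakTransport_eq_iSup hc (fun x => hbot _) hconv]
  refine le_antisymm (le_of_forall_lt fun r hr => ?_) (iSup_le fun ⟨⟨f, g⟩, hp⟩ => ?_)
  · obtain ⟨r', hr1, hr2⟩ := EReal.lt_iff_exists_real_btwn.1 hr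
    obtain ⟨f, g, hlt, hle⟩ := exists_pair_minorant hlsc hbot hjc hr2
    have hmem : (f, g) ∈ dualPairs fun x => T (diracProba x) := fun x σ => by
      have := hle (diracProba x) σ
      rwa [diracProba_coe, integral_dirac] at this
    exact (hr1.trans (EReal.coe_lt_coe_iff.2 hlt)).trans_le (le_iSup (fun p : dualPairs _ =>
      ((∫ x, p.1.1 x ∂(μ : Measure X) + ∫ y, p.1.2 y ∂(ν : Measure Y) : ℝ) : EReal)) ⟨(f, g), hmem⟩)
  · by_cases hμ : μ ∈ firstDomain T
    · have hle : ∀ x, S g x ≤ -f x := fun x => by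
        rw [← EReal.coe_le_coe_iff, hS.eq_legendre (hdirac x)]
        exact mem_dualPairs_iff.1 hp x
      obtain ⟨hint, heq⟩ := hS.2 μ hμ g
      refine le_trans (EReal.coe_le_coe_iff.2 ?_) (legendre_le_coe_iff.1 heq.le ν)
      have := integral_mono hint (integrable_continuousMap μ f).neg hle
      simp only [Pi.neg_apply] at this
      rw [integral_neg] at this
      simp only
      linarith
    · have : T μ ν = ⊤ := by
        by_contra h
        exact hμ ⟨ν, hbot μ ν, h⟩
      simp [this]

end Duality

end Transfer

theorem proposition5 {X Y : Type*}
    [TopologicalSpace X] [CompactSpace X] [TopologicalSpace.MetrizableSpace X]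
    [MeasurableSpace X] [BorelSpace X] [Nonempty X]
    [TopologicalSpace Y] [CompactSpace Y] [TopologicalSpace.MetrizableSpace Y]
    [MeasurableSpace Y] [BorelSpace Y]
    (T : ProbabilityMeasure X → ProbabilityMeasure Y → EReal)
    (hT : ∀ μ ν, T μ ν ≠ ⊥)
    (hdirac : ∀ x : X, diracProba x ∈ Transfer.firstDomain T) :
    (Transfer.IsBackwardLinearTransfer T ↔
      ∃ c : X → ProbabilityMeasure Y → EReal,
        (∀ x σ, c x σ ≠ ⊥) ∧
        LowerSemicontinuous (Function.uncurry c) ∧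
        (∀ x, Transfer.ConvexOnProb (c x)) ∧
        ∀ (μ : ProbabilityMeasure X) (ν : ProbabilityMeasure Y),
          T μ ν = Transfer.weakTransport c μ ν) ∧
    (Transfer.IsBackwardLinearTransfer T →
      ∀ S : C(Y, ℝ) → X → ℝ, Transfer.IsBackwardKantorovichOperator T S →
        ∀ (g : C(Y, ℝ)) (x : X),
          ((S g x : ℝ) : EReal) =
            ⨆ σ : ProbabilityMeasure Y,
              ((∫ y, g y ∂(σ : Measure Y) : ℝ) : EReal) - T (diracProba x) σ) := by
  refine ⟨⟨fun h => ?_, ?_⟩, fun _ S hS g x => hS.eq_legendre (hdirac x) g⟩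
  · have hc : LowerSemicontinuous (Function.uncurry fun x : X => T (diracProba x)) :=
      h.2.2.2.1.comp (continuous_diracProba.prodMap continuous_id)
    have hconv : ∀ x : X, Transfer.ConvexOnProb (T (diracProba x)) := fun x t σ₀ σ₁ => by
      simpa only [Transfer.mix_self] using h.2.2.1 t (diracProba x) (diracProba x) σ₀ σ₁
    exact ⟨fun x => T (diracProba x), fun x => hT _, hc, hconv, h.eq_weakTransport hdirac hc hconv⟩
  · rintro ⟨c, hbot, hc, hconv, hTc⟩
    obtain rfl : T = Transfer.weakTransport c := funext fun μ => funext (hTc μ)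
    exact Transfer.isBackwardLinearTransfer_weakTransport hc hbot hconv hT hdirac
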